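/- Let $m\ge 1$. For a nonzero real polynomial $P$ with $P(0)=0$ let its order of vanishing be the exponent of its lowest nonzero monomial. A family $\mathcal P=(P_1,\dots,P_m)$ of nonzero real polynomials with $P_i(0)=0$ is called relatively curved if the orders of vanishing $e_1,\dots,e_m$ of $P_1,\dots,P_m$ at the origin are pairwise distinct. Given real numbers $0<\sigma<C$, we say that $\mathbf P(\mathcal P)$ holds with gain $\sigma$ and constant $C$ if for all integers $l\ge C$, all real $N\ge 1$ and all Schwartz functions $f_1,\dots,f_m:\mathbb R\to\mathbb C$ such that for some $i$ the Fourier transform $\widehat{f_i}$ vanishes on $\{|\xi|\le N2^{le_i}\}$, $$\Big\|\int_0^1\prod_{i=1}^m f_i\big(x-P_i(2^{-l}t)\big)\,dt\Big\|_{L^1(dx)}\le C N^{-\sigma}\prod_{i=1}^m\|f_i\|_{L^m}.$$ For $A\subset\mathbb R$ let $H^s_\infty(A)=\inf\{\sum_n \operatorname{diam}(U_n)^s: A\subset\bigcup_n U_n\}$ denote the $s$-dimensional Hausdorff content. Theorem. There is a constant $C_m>0$, depending only on $m$, with the following property. Let $\mathcal P=(P_1,\dots,P_m)$ be relatively curved,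 and suppose that $\mathbf P(\mathcal P)$ holds with gain $\sigma_{\mathcal P}$ and constant $C_{\mathcal P}$. Then there is $c_0>0$, depending only on $\mathcal P,\sigma_{\mathcal P},C_{\mathcal P}$, such that whenever $a>0$, $c\le c_0$ and $c\le C_m\,\sigma_{\mathcal P}\,a^{10m}$, every compact set $A\subset[0,1]$ with $H^s_\infty(A)\ge a$ for some $s>1-c$ contains a non-trivial progression: there are $x,t\in[0,1]$ with $t\ne0$ and $$\{x,\ x-P_1(t),\ \dots,\ x-P_m(t)\}\subset A.$$ -/

import Mathlib

open MeasureTheory Polynomial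
open scoped SchwartzMap ENNReal FourierTransform

noncomputable section

/-- The `s`-dimensional Hausdorff content `H^s_∞(A)`: the infimum of `∑ diam(U n)^s` over all
countable covers of `A`; empty covering sets contribute nothing. -/
def hausdorffContent (s : ℝ) (A : Set ℝ) : ℝ≥0∞ :=
  ⨅ (U : ℕ → Set ℝ) (_ : A ⊆ ⋃ n, U n), ∑' n, ⨆ _ : (U n).Nonempty, Metric.ediam (U n) ^ s

/-- The order of vanishing at the origin of a (nonzero) polynomial: the exponent of its lowest
nonzero monomial. -/
def vanishingOrder (p : ℝ[X]) : ℕ := p.natTrailingDegree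

/-- The polynomials are nonzero, vanish at the origin, and do so to pairwise distinct orders. -/
structure RelativelyCurved {m : ℕ} (P : Fin m → ℝ[X]) : Prop where
  ne_zero : ∀ i, P i ≠ 0
  eval_zero : ∀ i, (P i).eval 0 = 0
  distinct_orders : Function.Injective fun i => vanishingOrder (P i)

/-- The average `x ↦ ∫_0^1 ∏ i, f i (x - P i (2^{-l} t)) dt`. -/
def polyAverage {m : ℕ} (P : Fin m → ℝ[X]) (l : ℕ) (f : Fin m → ℝ → ℂ) (x : ℝ) : ℂ :=
  ∫ t in (0 : ℝ)..1, ∏ i, f i (x - (P i).eval (t / 2 ^ l))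

/-- The Sobolev estimate for `P` with gain `σ` and constant `C`: for all scales `l ≥ C` and
all `N ≥ 1`, the `L¹` norm of the average is at most `C N^{-σ} ∏ ‖f i‖_{L^m}` as soon as the
Fourier transform of some `f i` vanishes on `|ξ| ≤ N 2^{l e_i}`, where `e_i` is the order of
vanishing of `P i` at the origin. -/
def SobolevEstimate {m : ℕ} (P : Fin m → ℝ[X]) (σ C : ℝ) : Prop :=
  0 < σ ∧ σ < C ∧
    ∀ l : ℕ, C ≤ (l : ℝ) → ∀ N : ℝ, 1 ≤ N → ∀ f : Fin m → 𝓢(ℝ, ℂ),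
      (∃ i, ∀ ξ : ℝ, |ξ| ≤ N * 2 ^ (l * vanishingOrder (P i)) →
        𝓕 (f i : ℝ → ℂ) ξ = 0) →
      eLpNorm (polyAverage P l fun i => (f i : ℝ → ℂ)) 1 volume ≤
        ENNReal.ofReal (C * N ^ (-σ)) * ∏ i, eLpNorm (f i : ℝ → ℂ) (m : ℝ≥0∞) volume

end

/-! The proof counts progressions with a multilinear form and finds one scale at which the count is
large. By Frostman's lemma `A` carries, for every `n`, a smooth density `F` living within `2^{-n}`
of `A`, of mass between `a` and `1`, giving mass `O(2^{-k(1-c)})` to intervals of length `2^{-k}`,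
`k ≤ n` (`exists_frostman`). The form `progForm` at scale `l` integrates `F(x) ∏ F(x - P_i(2^{-l}
t))` over `x` and `0 < t ≤ 1`. Truncating `F` to frequencies up to `2^k` gives functions of size
`O(2^{kc})`, so exponential gains from the Sobolev estimate beat these losses when `c` is small
compared with `σ`.

For fixed `l`, frequencies of the `i`-th factor above `2^{l e_i + ν}` are discarded by the Sobolev
estimate (`ScaleFamily.tail_le`, `ScaleFamily.norm_progForm_le`). Frequencies below `2^{l e_i - K}`
do not see the shift `P_i(2^{-l} t) = O(2^{-l e_i})`: with nonnegative averages at that scale in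
place of the factors, Hölder's inequality bounds the form below by a constant times `a^{m+1}`
(`ScaleFamily.le_re_progForm`). The intermediate band is controlled in `L²`: for `l` in a separated
sequence these bands are almost disjoint, so by Plancherel and pigeonholing some `l` has little
energy there (`ScaleFamily.sum_energy_le`, `ScaleFamily.exists_scale_lower_bound`).

With `Y` comparable to `a^{-(m+1)}`, about `Y²` scales with spacing about `Y` suffice, so only
frequencies up to `2^{O(Y³)}` matter. Taking `c` of order `Y^{-3}` makes all Frostman losses there
bounded, and `c ≤ κ a^{6m}` achieves this.

The step does not degenerate as `n` grows: if only `t ≤ 2^{-q}` contributed, rescaling would make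
the form `2^{-q}` times the form at scale `l + q`, which is `O(2^{(l+q)/2})`; this is too small for
large `q`. Compactness of `A` then turns approximate progressions into a genuine one. Finally, `κ`
depends on the polynomials, and an interpolation between `c ≤ c₀` and `c ≤ σ a^{10m}` yields `c ≤ κ
a^{6m}`. -/

noncomputable section

/-! ### Schwartz functions: frequency support, dilates and kernels. -/

/-- The Fourier transform of `f` is supported in `[-R, R]`. -/
def LowFreq (R : ℝ) (f : 𝓢(ℝ, ℂ)) : Prop := ∀ ξ : ℝ, R < |ξ| → 𝓕 f ξ = 0

/-- The Fourier transform of `f` vanishes on `[-R, R]`. -/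
def HighFreq (R : ℝ) (f : 𝓢(ℝ, ℂ)) : Prop := ∀ ξ : ℝ, |ξ| ≤ R → 𝓕 f ξ = 0

/-- Pointwise product of Schwartz functions. -/
def schwartzMul (f g : 𝓢(ℝ, ℂ)) : 𝓢(ℝ, ℂ) :=
  SchwartzMap.pairing (ContinuousLinearMap.mul ℂ ℂ) f g

lemma schwartzMul_apply (f g : 𝓢(ℝ, ℂ)) (x : ℝ) : schwartzMul f g x = f x * g x := by
  simp [schwartzMul]

/-- Convolution of Schwartz functions. -/
def schwartzConv (f g : 𝓢(ℝ, ℂ)) : 𝓢(ℝ, ℂ) :=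
  SchwartzMap.convolution (ContinuousLinearMap.mul ℂ ℂ) f g

lemma schwartzConv_apply (f g : 𝓢(ℝ, ℂ)) (x : ℝ) :
    schwartzConv f g x = ∫ y, f y * g (x - y) := by
  simp [schwartzConv, SchwartzMap.convolution_apply, convolution]

lemma schwartzConv_apply_swap (f g : 𝓢(ℝ, ℂ)) (x : ℝ) :
    schwartzConv f g x = ∫ y, f (x - y) * g y := by
  rw [schwartzConv_apply, ← integral_sub_left_eq_self _ volume x]
  simp

lemma fourier_schwartzConv (f g : 𝓢(ℝ, ℂ)) (ξ : ℝ) :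
    𝓕 (schwartzConv f g) ξ = 𝓕 f ξ * 𝓕 g ξ := by
  simp [schwartzConv, SchwartzMap.fourier_convolution]

lemma fourierInv_apply_neg (f : 𝓢(ℝ, ℂ)) (ξ : ℝ) : 𝓕⁻ f ξ = 𝓕 f (-ξ) := by
  rw [SchwartzMap.fourierInv_coe, SchwartzMap.fourier_coe, Real.fourierInv_eq_fourier_neg]

lemma fourierInv_schwartzMul (f g : 𝓢(ℝ, ℂ)) :
    𝓕⁻ (schwartzMul f g) = schwartzConv (𝓕⁻ f) (𝓕⁻ g) := by
  have h : 𝓕 (schwartzConv (𝓕⁻ f) (𝓕⁻ g)) = schwartzMul f g := by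
    ext ξ
    rw [fourier_schwartzConv, schwartzMul_apply]
    simp
  rw [← h]; simp

/-- The transform of a product is the convolution of the transforms, so the supports add. -/
lemma LowFreq.mul {R R' : ℝ} {f g : 𝓢(ℝ, ℂ)} (hf : LowFreq R f) (hg : LowFreq R' g) :
    LowFreq (R + R') (schwartzMul f g) := by
  intro ξ hξ
  have h := fourierInv_apply_neg (schwartzMul f g) (-ξ)
  rw [neg_neg] at h
  rw [← h, fourierInv_schwartzMul, schwartzConv_apply]
  rw [integral_eq_zero_of_ae]
  refine Filter.Eventually.of_forall fun y => ?_
  simp only [fourierInv_apply_neg, Pi.zero_apply, mul_eq_zero]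
  by_cases hy : R < |(-y)|
  · exact Or.inl (hf _ hy)
  · refine Or.inr (hg _ ?_)
    have h1 : |ξ| ≤ |(-y)| + |(-(-ξ - y))| := by
      have : ξ = -y + -(-ξ - y) := by ring
      conv_lhs => rw [this]
      exact abs_add_le _ _
    linarith [not_lt.1 hy]

lemma LowFreq.mono {R R' : ℝ} {f : 𝓢(ℝ, ℂ)} (hf : LowFreq R f) (h : R ≤ R') : LowFreq R' f :=
  fun ξ hξ => hf ξ (h.trans_lt hξ)

lemma HighFreq.mono {R R' : ℝ} {f : 𝓢(ℝ, ℂ)} (hf : HighFreq R f) (h : R' ≤ R) : HighFreq R' f :=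
  fun ξ hξ => hf ξ (hξ.trans h)

lemma fourier_compSubConst (f : 𝓢(ℝ, ℂ)) (s ξ : ℝ) (h : 𝓕 f ξ = 0) :
    𝓕 (f.compSubConstCLM ℂ s) ξ = 0 := by
  rw [SchwartzMap.fourier_coe] at h ⊢
  have h2 := congrFun (VectorFourier.fourierIntegral_comp_add_right Real.fourierChar volume
    (innerₗ ℝ) (f : ℝ → ℂ) (-s)) ξ
  have e : (f.compSubConstCLM ℂ s : ℝ → ℂ) = (f : ℝ → ℂ) ∘ fun v => v + -s := by
    ext x; simp [sub_eq_add_neg]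
  rw [e]
  refine h2.trans ?_
  have h' : VectorFourier.fourierIntegral Real.fourierChar volume (innerₗ ℝ) (f : ℝ → ℂ) ξ = 0 := h
  simp [h']

lemma LowFreq.compSubConst {R : ℝ} {f : 𝓢(ℝ, ℂ)} (hf : LowFreq R f) (s : ℝ) :
    LowFreq R (f.compSubConstCLM ℂ s) :=
  fun ξ hξ => fourier_compSubConst f s ξ (hf ξ hξ)

lemma integral_mul_eq_zero_of_freq {R : ℝ} {h g : 𝓢(ℝ, ℂ)} (hh : HighFreq R h)
    (hg : LowFreq R g) : ∫ x, h x * g x = 0 := by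
  have e : ∫ x, h x * g x = ∫ ξ, 𝓕 h ξ * 𝓕⁻ g ξ := by
    rw [SchwartzMap.integral_fourier_mul_eq]
    simp
  rw [e, integral_eq_zero_of_ae]
  refine Filter.Eventually.of_forall fun ξ => ?_
  simp only [fourierInv_apply_neg, Pi.zero_apply, mul_eq_zero]
  by_cases hy : |ξ| ≤ R
  · exact Or.inl (hh _ hy)
  · exact Or.inr (hg _ (by rw [abs_neg]; linarith))

lemma exists_prod_lowFreq {ι : Type*} {R : ℝ} (g : ι → 𝓢(ℝ, ℂ)) (hg : ∀ i, LowFreq R (g i))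
    (s : Finset ι) (hs : s.Nonempty) :
    ∃ Q : 𝓢(ℝ, ℂ), (∀ x, Q x = ∏ i ∈ s, g i x) ∧ LowFreq (s.card * R) Q := by
  classical
  induction hs using Finset.Nonempty.cons_induction with
  | singleton i => exact ⟨g i, by simp, by simpa using hg i⟩
  | cons i s hi hs ih =>
    obtain ⟨Q, hQ, hQR⟩ := ih
    refine ⟨schwartzMul (g i) Q, fun x => ?_, ?_⟩
    · rw [schwartzMul_apply, hQ, Finset.prod_cons]
    · refine ((hg i).mul hQR).mono ?_
      rw [Finset.card_cons]; push_cast; linarith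

/-- A product of translates of low-frequency functions is orthogonal to a function of
sufficiently high frequency. -/
lemma integral_mul_prod_eq_zero {m : ℕ} (hm : 1 ≤ m) {R : ℝ} {h : 𝓢(ℝ, ℂ)}
    {g : Fin m → 𝓢(ℝ, ℂ)} (hh : HighFreq (m * R) h) (hg : ∀ i, LowFreq R (g i))
    (s : Fin m → ℝ) : ∫ x, h x * ∏ i, g i (x - s i) = 0 := by
  have : Nonempty (Fin m) := ⟨⟨0, hm⟩⟩
  obtain ⟨Q, hQ, hQR⟩ := exists_prod_lowFreq (fun i => (g i).compSubConstCLM ℂ (s i))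
    (fun i => (hg i).compSubConst (s i)) Finset.univ Finset.univ_nonempty
  have := integral_mul_eq_zero_of_freq hh (by simpa using hQR)
  simpa [hQ] using this

/-- The `L¹`-normalized dilate `x ↦ 2^k f (2^k x)`. -/
def dilate (k : ℕ) (f : 𝓢(ℝ, ℂ)) : 𝓢(ℝ, ℂ) :=
  (2 : ℂ) ^ k • SchwartzMap.compCLMOfContinuousLinearEquiv ℂ
    (ContinuousLinearEquiv.unitsEquivAut ℝ (Units.mk0 ((2 : ℝ) ^ k) (by positivity))) f

lemma dilate_apply (k : ℕ) (f : 𝓢(ℝ, ℂ)) (x : ℝ) :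
    dilate k f x = (2 : ℂ) ^ k * f (2 ^ k * x) := by
  simp [dilate, mul_comm]

lemma fourier_dilate (k : ℕ) (f : 𝓢(ℝ, ℂ)) (ξ : ℝ) :
    𝓕 (dilate k f) ξ = 𝓕 f (ξ / 2 ^ k) := by
  rw [SchwartzMap.fourier_coe, SchwartzMap.fourier_coe, Real.fourier_real_eq, Real.fourier_real_eq]
  have h := Measure.integral_comp_mul_left
    (fun v : ℝ => Real.fourierChar (-(v * (ξ / 2 ^ k))) • f v) ((2 : ℝ) ^ k)
  have h2 : ∀ v : ℝ, Real.fourierChar (-(v * ξ)) • dilate k f v =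
      (2 : ℂ) ^ k * (Real.fourierChar (-((2 ^ k * v) * (ξ / 2 ^ k))) • f (2 ^ k * v)) := by
    intro v
    rw [dilate_apply]
    have : (2 ^ k * v) * (ξ / 2 ^ k) = v * ξ := by field_simp
    rw [this]
    simp only [Circle.smul_def, smul_eq_mul]; ring
  simp_rw [h2]
  rw [integral_const_mul, h]
  rw [abs_of_pos (by positivity), Complex.real_smul, ← mul_assoc]
  push_cast
  rw [mul_inv_cancel₀ (pow_ne_zero _ two_ne_zero), one_mul]

/-- A Schwartz function whose Fourier transform is a smooth cutoff. -/
lemma exists_cutoff : ∃ φ : 𝓢(ℝ, ℂ), (∀ ξ : ℝ, |ξ| ≤ 1 → 𝓕 φ ξ = 1) ∧ LowFreq 2 φ ∧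
    (∀ ξ, ‖𝓕 φ ξ‖ ≤ 1) ∧ φ 0 ≠ 0 := by
  let b : ContDiffBump (0 : ℝ) := ⟨1, 2, by norm_num, by norm_num⟩
  have h1 : HasCompactSupport (fun x : ℝ => ((b x : ℝ) : ℂ)) :=
    b.hasCompactSupport.comp_left (g := fun r : ℝ => (r : ℂ)) (by simp)
  have h2 : ContDiff ℝ ((⊤ : ℕ∞) : WithTop ℕ∞) (fun x : ℝ => ((b x : ℝ) : ℂ)) :=
    Complex.ofRealCLM.contDiff.comp b.contDiff
  let χ : 𝓢(ℝ, ℂ) := h1.toSchwartzMap h2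
  have hχ : ∀ x, χ x = (b x : ℂ) := fun x => rfl
  have e : 𝓕 (𝓕⁻ χ) = χ := by simp
  refine ⟨𝓕⁻ χ, fun ξ hξ => ?_, fun ξ hξ => ?_, fun ξ => ?_, ?_⟩
  · rw [e, hχ, b.one_of_mem_closedBall (by simpa [b] using hξ)]; simp
  · rw [e, hχ, b.zero_of_le_dist (by simpa [b] using hξ.le)]; simp
  · rw [e, hχ, Complex.norm_real, Real.norm_of_nonneg b.nonneg]; exact b.le_one
  · rw [SchwartzMap.fourierInv_coe, Real.fourierInv_eq]
    simp only [inner_zero_right, AddChar.map_zero_eq_one, one_smul, hχ]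
    rw [integral_complex_ofReal]
    exact_mod_cast b.integral_pos.ne'

/-- Pointwise complex conjugate of a Schwartz function. -/
def schwartzConj (f : 𝓢(ℝ, ℂ)) : 𝓢(ℝ, ℂ) :=
  SchwartzMap.postcompCLM (𝕜 := ℝ) (Complex.conjCLE : ℂ →L[ℝ] ℂ) f

lemma schwartzConj_apply (f : 𝓢(ℝ, ℂ)) (x : ℝ) :
    schwartzConj f x = (starRingEnd ℂ) (f x) := rfl

lemma fourier_schwartzConj (f : 𝓢(ℝ, ℂ)) (ξ : ℝ) :
    𝓕 (schwartzConj f) ξ = (starRingEnd ℂ) (𝓕 f (-ξ)) := by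
  rw [SchwartzMap.fourier_coe, SchwartzMap.fourier_coe, Real.fourier_real_eq, Real.fourier_real_eq,
    ← integral_conj]
  refine integral_congr_ae (Filter.Eventually.of_forall fun v => ?_)
  simp only [Circle.smul_def, smul_eq_mul, map_mul, schwartzConj_apply, mul_neg, neg_neg]
  rw [← Circle.coe_inv_eq_conj, ← AddChar.map_neg_eq_inv]

lemma LowFreq.conj {R : ℝ} {f : 𝓢(ℝ, ℂ)} (hf : LowFreq R f) : LowFreq R (schwartzConj f) := by
  intro ξ hξ
  rw [fourier_schwartzConj, hf _ (by rwa [abs_neg]), map_zero]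

/-- A nonnegative Schwartz function of integral one and compact frequency support. -/
lemma exists_nonneg_kernel : ∃ (ψ : 𝓢(ℝ, ℂ)) (w : ℝ → ℝ) (δ c₁ : ℝ), (∀ x, ψ x = (w x : ℂ)) ∧
    (∀ x, 0 ≤ w x) ∧ 𝓕 ψ 0 = 1 ∧ LowFreq 4 ψ ∧ 0 < δ ∧ 0 < c₁ ∧
    (∀ x, |x| ≤ δ → c₁ ≤ w x) := by
  obtain ⟨φ, -, hlow, -, h0⟩ := exists_cutoff
  -- The kernel is `|φ|²` normalized: squaring gives positivity and doubles the frequency support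
  -- from `2` to `4`, while `φ 0 ≠ 0` gives the lower bound near the origin.
  set Q := schwartzMul φ (schwartzConj φ) with hQ
  have hQx : ∀ x, Q x = ((‖φ x‖ ^ 2 : ℝ) : ℂ) := fun x => by
    rw [hQ, schwartzMul_apply, schwartzConj_apply, Complex.mul_conj, Complex.normSq_eq_norm_sq]
  have hcont : Continuous fun x => ‖φ x‖ ^ 2 := (φ.continuous.norm.pow 2)
  have hint : Integrable fun x => ‖φ x‖ ^ 2 := by
    refine (Q.integrable (μ := volume)).norm.congr (Filter.Eventually.of_forall fun x => ?_)
    simp [hQx]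
  have h0' : (0 : ℝ) < ‖φ 0‖ ^ 2 := by positivity
  have hI : 0 < ∫ x, ‖φ x‖ ^ 2 :=
    integral_pos_of_integrable_nonneg_nonzero hcont hint (fun x => by positivity) h0'.ne'
  set I := ∫ x, ‖φ x‖ ^ 2 with hIdef
  obtain ⟨δ, hδ, hδ2⟩ := Metric.eventually_nhds_iff.1
    (hcont.continuousAt.eventually (lt_mem_nhds (half_lt_self h0')))
  refine ⟨((I⁻¹ : ℝ) : ℂ) • Q, fun x => I⁻¹ * ‖φ x‖ ^ 2, δ / 2, I⁻¹ * (‖φ 0‖ ^ 2 / 2), fun x => ?_,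
    fun x => by positivity, ?_, fun ξ hξ => ?_, by positivity, by positivity, fun x hx => ?_⟩
  · simp [hQx]
  · rw [SchwartzMap.fourier_coe, Real.fourier_real_eq]
    simp only [mul_zero, neg_zero, AddChar.map_zero_eq_one, one_smul, smul_apply, hQx,
      smul_eq_mul]
    rw [integral_const_mul, integral_complex_ofReal, ← hIdef, ← Complex.ofReal_mul,
      inv_mul_cancel₀ hI.ne', Complex.ofReal_one]
  · rw [FourierTransform.fourier_smul, smul_apply,
      (hlow.mul hlow.conj) ξ (by linarith), smul_zero]
  · have := hδ2 (y := x) (by rw [Real.dist_eq, sub_zero]; linarith)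
    exact mul_le_mul_of_nonneg_left this.le (by positivity)

/-- The transform is again Schwartz, hence bounded with bounded derivative. The Lipschitz bound at
`0` supplies the low-frequency cancellation in `multiplier_sq_le`. -/
lemma exists_fourier_lipschitz (ψ : 𝓢(ℝ, ℂ)) :
    ∃ C₀ : ℝ, 0 < C₀ ∧ (∀ ξ, ‖𝓕 ψ ξ‖ ≤ C₀) ∧ ∀ ξ, ‖𝓕 ψ ξ - 𝓕 ψ 0‖ ≤ C₀ * |ξ| := by
  set A := SchwartzMap.seminorm ℝ 0 0 (𝓕 ψ)
  set D := SchwartzMap.seminorm ℝ 0 0 (SchwartzMap.derivCLM ℝ ℂ (𝓕 ψ))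
  have hA : 0 ≤ A := apply_nonneg _ _
  have hD : 0 ≤ D := apply_nonneg _ _
  refine ⟨A + D + 1, by positivity, fun ξ => ?_, fun ξ => ?_⟩
  · have := SchwartzMap.norm_le_seminorm ℝ (𝓕 ψ) ξ
    linarith
  · have h := Convex.norm_image_sub_le_of_norm_deriv_le (f := (𝓕 ψ : 𝓢(ℝ, ℂ))) (C := D)
      (s := Set.univ) (fun x _ => (𝓕 ψ : 𝓢(ℝ, ℂ)).differentiableAt)
      (fun x _ => SchwartzMap.norm_le_seminorm ℝ (SchwartzMap.derivCLM ℝ ℂ (𝓕 ψ)) x)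
      convex_univ (Set.mem_univ 0) (Set.mem_univ ξ)
    rw [sub_zero, Real.norm_eq_abs] at h
    nlinarith [abs_nonneg ξ]

end

/-! ### Frostman densities and their approximations at dyadic scales. -/

noncomputable section

/-- `F` is a nonnegative Schwartz density `f` obeying a Frostman condition of exponent `1 - c`
down to the scale `2^{-n}`. -/
structure IsFrostman (c B : ℝ) (n : ℕ) (F : 𝓢(ℝ, ℂ)) (f : ℝ → ℝ) : Prop where
  eq_coe : ∀ x, F x = (f x : ℂ)
  nonneg : ∀ x, 0 ≤ f x
  integral_le_one : ∫ x, f x ≤ 1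
  le_bound : ∀ x, f x ≤ B * (2 : ℝ) ^ ((n : ℝ) * c)
  interval_le : ∀ k : ℕ, k ≤ n → ∀ z : ℝ,
    ∫ y in Set.Icc z (z + (2 ^ k)⁻¹), f y ≤ B * (2 : ℝ) ^ (-(k : ℝ) * (1 - c))
  support_subset : ∀ x, f x ≠ 0 → x ∈ Set.Icc (-1 : ℝ) 2

lemma exists_decay (K : 𝓢(ℝ, ℂ)) : ∃ D : ℝ, 0 < D ∧ ∀ u, ‖K u‖ ≤ D / (1 + u ^ 2) := by
  set A := SchwartzMap.seminorm ℝ 0 0 K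
  set E := SchwartzMap.seminorm ℝ 2 0 K
  have hA : 0 ≤ A := apply_nonneg _ _
  have hE : 0 ≤ E := apply_nonneg _ _
  refine ⟨A + E + 1, by positivity, fun u => ?_⟩
  rw [le_div_iff₀ (by positivity)]
  have h1 := SchwartzMap.norm_le_seminorm ℝ K u
  have h2 := SchwartzMap.norm_pow_mul_le_seminorm ℝ K 2 u
  rw [Real.norm_eq_abs, sq_abs] at h2
  nlinarith

lemma summable_one_div_one_add_sq : Summable fun j : ℤ => 1 / (1 + (j : ℝ) ^ 2) := by
  have h := (Real.summable_one_div_int_pow (p := 2)).2 (by norm_num)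
  refine Summable.of_norm_bounded_eventually h ?_
  filter_upwards [Filter.eventually_cofinite_ne (0 : ℤ)] with j hj
  have : 0 < (j : ℝ) ^ 2 := by positivity
  rw [Real.norm_of_nonneg (by positivity)]
  exact one_div_le_one_div_of_le this (by linarith)

lemma integrable_weight {f : ℝ → ℝ} (hf : Integrable f) (hf0 : ∀ x, 0 ≤ f x) (x r : ℝ) :
    Integrable fun y => f y / (1 + ((x - y) / r) ^ 2) := by
  refine Integrable.mono' hf ?_ (Filter.Eventually.of_forall fun y => ?_)
  · refine (hf.aestronglyMeasurable.aemeasurable.div ?_).aestronglyMeasurable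
    exact (by fun_prop : Continuous fun y : ℝ => 1 + ((x - y) / r) ^ 2).aemeasurable
  · rw [Real.norm_of_nonneg (div_nonneg (hf0 y) (by positivity))]
    exact div_le_self (hf0 y) (by nlinarith [sq_nonneg ((x - y) / r)])

/-- A function with uniformly bounded mass on intervals of length `r` has bounded mass against
the weight `1 / (1 + ((x - y) / r)²)`. -/
lemma integral_weight_le {f : ℝ → ℝ} (hf : Integrable f) (hf0 : ∀ x, 0 ≤ f x) {r M : ℝ}
    (hr : 0 < r) (hM : ∀ z, ∫ y in Set.Icc z (z + r), f y ≤ M) (x : ℝ) :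
    ∫ y, f y / (1 + ((x - y) / r) ^ 2) ≤ 3 * (∑' j : ℤ, 1 / (1 + (j : ℝ) ^ 2)) * M := by
  have hint := integrable_weight hf hf0 x r
  have hs := hasSum_integral_iUnion (μ := volume) (f := fun y => f y / (1 + ((x - y) / r) ^ 2))
    (s := fun j : ℤ => Set.Ioc (x + j • r) (x + (j + 1) • r)) (fun j => measurableSet_Ioc)
    (Set.pairwise_disjoint_Ioc_add_zsmul x r) hint.integrableOn
  rw [iUnion_Ioc_add_zsmul hr, setIntegral_univ] at hs
  have hs2 := (summable_one_div_one_add_sq.hasSum.mul_left 3).mul_right M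
  refine hasSum_le (fun j => ?_) hs hs2
  -- On the `j`-th cell `u = (x - y) / r` lies in `[-(j+1), -j)`, so `1 + j² ≤ 3 (1 + u²)`; this is
  -- the source of the factor `3`.
  have h1 : ∀ y ∈ Set.Ioc (x + j • r) (x + (j + 1) • r),
      f y / (1 + ((x - y) / r) ^ 2) ≤ (3 * (1 / (1 + (j : ℝ) ^ 2))) * f y := by
    intro y hy
    simp only [zsmul_eq_mul, Int.cast_add, Int.cast_one, Set.mem_Ioc] at hy
    set u := (x - y) / r with hu
    have hy' : x - y = u * r := by rw [hu]; field_simp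
    have h1 : u < -j := by
      by_contra! h
      nlinarith
    have h2 : -(j + 1) ≤ u := by
      by_contra! h
      nlinarith
    have h3 : 1 + (j : ℝ) ^ 2 ≤ 3 * (1 + u ^ 2) := by
      nlinarith [sq_nonneg (2 * u + j), mul_nonneg (sub_nonneg.2 h1.le) (sub_nonneg.2 h2)]
    rw [div_le_iff₀ (by positivity)]
    have : 1 ≤ 3 * (1 / (1 + (j : ℝ) ^ 2)) * (1 + u ^ 2) := by
      rw [mul_one_div, div_mul_eq_mul_div, le_div_iff₀ (by positivity)]; linarith
    nlinarith [hf0 y]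
  calc ∫ y in Set.Ioc (x + j • r) (x + (j + 1) • r), f y / (1 + ((x - y) / r) ^ 2)
      ≤ ∫ y in Set.Ioc (x + j • r) (x + (j + 1) • r), (3 * (1 / (1 + (j : ℝ) ^ 2))) * f y :=
        setIntegral_mono_on hint.integrableOn (hf.const_mul _).integrableOn measurableSet_Ioc h1
    _ = (3 * (1 / (1 + (j : ℝ) ^ 2))) *
        ∫ y in Set.Ioc (x + j • r) (x + (j + 1) • r), f y := integral_const_mul _ _
    _ ≤ (3 * (1 / (1 + (j : ℝ) ^ 2))) * M := by
        gcongr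
        refine le_trans ?_ (hM (x + j • r))
        refine setIntegral_mono_set hf.integrableOn (Filter.Eventually.of_forall hf0)
          (LE.le.eventuallyLE ?_)
        intro y hy
        simp only [zsmul_eq_mul, Int.cast_add, Int.cast_one, Set.mem_Ioc, Set.mem_Icc] at hy ⊢
        constructor <;> linarith

lemma IsFrostman.integrable {c B : ℝ} {n : ℕ} {F : 𝓢(ℝ, ℂ)} {f : ℝ → ℝ}
    (h : IsFrostman c B n F f) : Integrable f := by
  refine (F.integrable (μ := volume)).norm.congr (Filter.Eventually.of_forall fun x => ?_)
  simp [h.eq_coe, abs_of_nonneg (h.nonneg x)]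

lemma IsFrostman.norm_eq {c B : ℝ} {n : ℕ} {F : 𝓢(ℝ, ℂ)} {f : ℝ → ℝ}
    (h : IsFrostman c B n F f) (x : ℝ) : ‖F x‖ = f x := by
  rw [h.eq_coe, Complex.norm_real, Real.norm_of_nonneg (h.nonneg x)]

/-- Convolving a Frostman density with a kernel at scale `2^{-k}` loses at most `2^{kc}`. -/
lemma exists_norm_conv_le (K : 𝓢(ℝ, ℂ)) : ∃ D : ℝ, 0 < D ∧
    ∀ (c B : ℝ) (n : ℕ) (F : 𝓢(ℝ, ℂ)) (f : ℝ → ℝ), IsFrostman c B n F f → 0 ≤ B →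
    ∀ k ≤ n, ∀ x, ‖schwartzConv (dilate k K) F x‖ ≤ D * B * (2 : ℝ) ^ ((k : ℝ) * c) := by
  obtain ⟨D, hD, hK⟩ := exists_decay K
  set S := ∑' j : ℤ, 1 / (1 + (j : ℝ) ^ 2)
  have hS : 0 ≤ S := tsum_nonneg fun j => by positivity
  refine ⟨D * (3 * S) + 1, by positivity, fun c B n F f h hB k hk x => ?_⟩
  have hw := integral_weight_le h.integrable h.nonneg (r := (2 ^ k)⁻¹) (by positivity)
    (h.interval_le k hk) x
  have hint := integrable_weight h.integrable h.nonneg x ((2 ^ k)⁻¹)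
  rw [schwartzConv_apply_swap]
  calc ‖∫ y, dilate k K (x - y) * F y‖
      ≤ ∫ y, 2 ^ k * D * (f y / (1 + ((x - y) / (2 ^ k)⁻¹) ^ 2)) := by
        refine norm_integral_le_of_norm_le (hint.const_mul _)
          (Filter.Eventually.of_forall fun y => ?_)
        rw [norm_mul, h.norm_eq, dilate_apply, norm_mul, norm_pow, Complex.norm_ofNat]
        have := hK (2 ^ k * (x - y))
        have e : (x - y) / (2 ^ k : ℝ)⁻¹ = 2 ^ k * (x - y) := by field_simp
        rw [e]
        calc 2 ^ k * ‖K (2 ^ k * (x - y))‖ * f y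
            ≤ 2 ^ k * (D / (1 + (2 ^ k * (x - y)) ^ 2)) * f y := by
              have := h.nonneg y
              gcongr
          _ = _ := by ring
    _ = 2 ^ k * D * ∫ y, f y / (1 + ((x - y) / (2 ^ k)⁻¹) ^ 2) := integral_const_mul _ _
    _ ≤ 2 ^ k * D * (3 * S * (B * (2 : ℝ) ^ (-(k : ℝ) * (1 - c)))) := by gcongr
    _ = D * (3 * S) * B * (2 : ℝ) ^ ((k : ℝ) * c) := by
        have : (2 : ℝ) ^ ((k : ℝ) * c) = 2 ^ k * (2 : ℝ) ^ (-(k : ℝ) * (1 - c)) := by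
          rw [← Real.rpow_natCast, ← Real.rpow_add two_pos]; congr 1; ring
        rw [this]; ring
    _ ≤ _ := by
        have : 0 ≤ B * (2 : ℝ) ^ ((k : ℝ) * c) := by positivity
        nlinarith

lemma integral_norm_dilate (k : ℕ) (K : 𝓢(ℝ, ℂ)) : ∫ x, ‖dilate k K x‖ = ∫ x, ‖K x‖ := by
  simp_rw [dilate_apply, norm_mul, norm_pow, Complex.norm_ofNat]
  rw [integral_const_mul, Measure.integral_comp_mul_left (fun x => ‖K x‖)]
  rw [abs_of_pos (by positivity), smul_eq_mul, ← mul_assoc, mul_inv_cancel₀ (by positivity),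
    one_mul]

lemma integral_norm_schwartzConv_le (K F : 𝓢(ℝ, ℂ)) :
    ∫ x, ‖schwartzConv K F x‖ ≤ (∫ x, ‖K x‖) * ∫ x, ‖F x‖ := by
  have hi := (K.integrable (μ := volume)).norm.integrable_convolution
    (ContinuousLinearMap.mul ℝ ℝ) (F.integrable (μ := volume)).norm
  have h := integral_convolution (ContinuousLinearMap.mul ℝ ℝ) (K.integrable (μ := volume)).norm
    (F.integrable (μ := volume)).norm
  rw [ContinuousLinearMap.mul_apply'] at h
  rw [← h]
  refine integral_mono (schwartzConv K F).integrable.norm hi fun x => ?_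
  simp only [schwartzConv_apply, convolution, ContinuousLinearMap.mul_apply']
  refine (norm_integral_le_integral_norm _).trans (le_of_eq ?_)
  simp

/-- Littlewood–Paley approximations `G k` and nonnegative averages `H k` (with real values `h k`)
of a density `F` at the scales `2^{-k}`. -/
structure ScaleFamily (c B δ c₁ C₀ : ℝ) (n : ℕ) (F : 𝓢(ℝ, ℂ)) (f : ℝ → ℝ)
    (G H : ℕ → 𝓢(ℝ, ℂ)) (h : ℕ → ℝ → ℝ) : Prop where
  low : ∀ k ≤ n, LowFreq (2 ^ (k + 1)) (G k)
  high : ∀ k k', k ≤ k' → HighFreq (2 ^ k) (G k' - G k)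
  eq_of_lt : ∀ k, n < k → G k = F
  norm_le : ∀ k x, ‖G k x‖ ≤ B * (2 : ℝ) ^ ((k : ℝ) * c)
  integral_norm_le : ∀ k, ∫ x, ‖G k x‖ ≤ B
  coe_eq : ∀ k x, H k x = (h k x : ℂ)
  nonneg : ∀ k x, 0 ≤ h k x
  low' : ∀ k, LowFreq (2 ^ (k + 2)) (H k)
  norm_le' : ∀ k ≤ n, ∀ x, ‖H k x‖ ≤ B * (2 : ℝ) ^ ((k : ℝ) * c)
  lower : ∀ k x, c₁ * 2 ^ k * ∫ y in Set.Icc (x - δ / 2 ^ k) (x + δ / 2 ^ k), f y ≤ h k x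
  energy : ∀ k ≤ n, ∀ k' < k, ∀ ξ : ℝ, ‖𝓕 (G k) ξ - 𝓕 (H k') ξ‖ ^ 2 ≤
    C₀ * (min (2 * |ξ| / 2 ^ k') 1 - min (|ξ| / 2 ^ (k + 2)) 1) * ‖𝓕 F ξ‖ ^ 2

/-- The difference of multipliers is `O(|ξ| / 2^{k'})` at low frequencies and vanishes beyond
`2^{k+1}`. The majorant is written as a difference of two truncated linear functions so that it
telescopes when summed over separated pairs `(k', k)`. -/
lemma multiplier_sq_le {φ ψ : 𝓢(ℝ, ℂ)} (hφ1 : ∀ ξ : ℝ, |ξ| ≤ 1 → 𝓕 φ ξ = 1) (hφ2 : LowFreq 2 φ)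
    (hφ3 : ∀ ξ, ‖𝓕 φ ξ‖ ≤ 1) (hψ0 : 𝓕 ψ 0 = 1) (hψ : LowFreq 4 ψ) {C₀ : ℝ} (hC₀ : 0 < C₀)
    (hψ1 : ∀ ξ, ‖𝓕 ψ ξ‖ ≤ C₀) (hψ2 : ∀ ξ, ‖𝓕 ψ ξ - 𝓕 ψ 0‖ ≤ C₀ * |ξ|) {k k' : ℕ} (hk : k' < k)
    (ξ : ℝ) : ‖𝓕 φ (ξ / 2 ^ k) - 𝓕 ψ (ξ / 2 ^ k')‖ ^ 2 ≤
      2 * (1 + C₀) ^ 2 * (min (2 * |ξ| / 2 ^ k') 1 - min (|ξ| / 2 ^ (k + 2)) 1) := by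
  set x := |ξ| / 2 ^ k' with hx
  set y := |ξ| / 2 ^ k with hy
  have hx0 : 0 ≤ x := by positivity
  have hy0 : 0 ≤ y := by positivity
  have hyx : y ≤ x / 2 := by
    rw [hx, hy, div_div]
    gcongr
    rw [← pow_succ]
    exact pow_le_pow_right₀ one_le_two hk
  have e1 : 2 * |ξ| / 2 ^ k' = 2 * x := by rw [hx]; ring
  have e2 : |ξ| / 2 ^ (k + 2) = y / 4 := by rw [hy, pow_add, div_div]; norm_num
  have ax : |ξ / 2 ^ k'| = x := by rw [abs_div, abs_of_pos (by positivity : (0 : ℝ) < 2 ^ k')]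
  have ay : |ξ / 2 ^ k| = y := by rw [abs_div, abs_of_pos (by positivity : (0 : ℝ) < 2 ^ k)]
  rw [e1, e2]
  -- For `y > 2` one has `x ≥ 2y > 4` and both multipliers vanish. For `y ≤ 2` and `x ≥ 1/2` the
  -- majorant is at least `1/2`. For `x < 1/2` it is at least `x`, while the first multiplier equals
  -- `1 = 𝓕 ψ 0`.
  by_cases h1 : 2 < y
  · rw [hφ2 _ (by rwa [ay]), hψ _ (by rw [ax]; linarith)]
    have : min (y / 4) 1 ≤ min (2 * x) 1 := min_le_min_right _ (by linarith)
    have h2 : 0 ≤ 2 * (1 + C₀) ^ 2 * (min (2 * x) 1 - min (y / 4) 1) :=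
      mul_nonneg (by positivity) (by linarith)
    simpa using h2
  push Not at h1
  have h4 : min (y / 4) 1 ≤ y / 4 := min_le_left _ _
  by_cases h2 : 1 / 2 ≤ x
  · have h3 : min (2 * x) 1 = 1 := min_eq_right (by linarith)
    have h5 : ‖𝓕 φ (ξ / 2 ^ k) - 𝓕 ψ (ξ / 2 ^ k')‖ ≤ 1 + C₀ :=
      (norm_sub_le _ _).trans (add_le_add (hφ3 _) (hψ1 _))
    have h6 := pow_le_pow_left₀ (norm_nonneg _) h5 2
    rw [h3]
    nlinarith [sq_nonneg (1 + C₀)]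
  · push Not at h2
    have h3 : min (2 * x) 1 = 2 * x := min_eq_left (by linarith)
    have h5 : ‖𝓕 φ (ξ / 2 ^ k) - 𝓕 ψ (ξ / 2 ^ k')‖ ≤ C₀ * x := by
      rw [hφ1 _ (by rw [ay]; linarith), ← hψ0, norm_sub_rev, ← ax]
      exact hψ2 _
    have h6 := pow_le_pow_left₀ (norm_nonneg _) h5 2
    rw [h3]
    have h7 : (C₀ * x) ^ 2 ≤ (1 + C₀) ^ 2 * x := by
      rw [mul_pow]
      have : C₀ ^ 2 ≤ (1 + C₀) ^ 2 := by nlinarith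
      have : x ^ 2 ≤ x := by nlinarith
      gcongr
    nlinarith [mul_nonneg (sq_nonneg (1 + C₀)) hx0]

/-- Two kernels are needed. Convolution with dilates of `φ` reproduces low frequencies exactly, as
the Sobolev estimate requires, but need not be nonnegative; convolution with dilates of `ψ` is
nonnegative, as the Hölder lower bound requires. The energy inequality allows passing from one to
the other. -/
lemma exists_scaleFamily : ∃ δ c₁ C₀ : ℝ, 0 < δ ∧ 0 < c₁ ∧ 0 < C₀ ∧ ∀ B : ℝ, 1 ≤ B →
    ∃ B' : ℝ, 1 ≤ B' ∧ ∀ (c : ℝ) (n : ℕ) (F : 𝓢(ℝ, ℂ)) (f : ℝ → ℝ), 0 ≤ c →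
      IsFrostman c B n F f →
      ∃ (G H : ℕ → 𝓢(ℝ, ℂ)) (h : ℕ → ℝ → ℝ), ScaleFamily c B' δ c₁ C₀ n F f G H h := by
  obtain ⟨φ, hφ1, hφ2, hφ3, -⟩ := exists_cutoff
  obtain ⟨ψ, w, δ, c₁, hψw, hw, hψ0, hψ, hδ, hc₁, hwc⟩ := exists_nonneg_kernel
  obtain ⟨C₀, hC₀, hψ1, hψ2⟩ := exists_fourier_lipschitz ψ
  obtain ⟨D, hD, hDφ⟩ := exists_norm_conv_le φ
  obtain ⟨D', hD', hDψ⟩ := exists_norm_conv_le ψ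
  refine ⟨δ, c₁, 2 * (1 + C₀) ^ 2, hδ, hc₁, by positivity, fun B hB => ?_⟩
  have hφi : 0 ≤ ∫ x, ‖φ x‖ := integral_nonneg fun _ => norm_nonneg _
  refine ⟨B + D * B + D' * B + ∫ x, ‖φ x‖, by nlinarith, fun c n F f hc hF => ?_⟩
  have hDB : 0 ≤ D * B := by positivity
  have hDB' : 0 ≤ D' * B := by positivity
  have hFi : ∫ x, ‖F x‖ ≤ 1 := by simp_rw [hF.norm_eq]; exact hF.integral_le_one
  have hFi0 : 0 ≤ ∫ x, ‖F x‖ := integral_nonneg fun _ => norm_nonneg _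
  have hS : ∀ k ξ, 𝓕 (schwartzConv (dilate k φ) F) ξ = 𝓕 φ (ξ / 2 ^ k) * 𝓕 F ξ := fun k ξ => by
    rw [fourier_schwartzConv, fourier_dilate]
  have hT : ∀ k ξ, 𝓕 (schwartzConv (dilate k ψ) F) ξ = 𝓕 ψ (ξ / 2 ^ k) * 𝓕 F ξ := fun k ξ => by
    rw [fourier_schwartzConv, fourier_dilate]
  have habs : ∀ (k : ℕ) (ξ : ℝ), |ξ / 2 ^ k| = |ξ| / 2 ^ k := fun k ξ => by
    rw [abs_div, abs_of_pos (by positivity : (0 : ℝ) < 2 ^ k)]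
  have hS1 : ∀ (k : ℕ) (ξ : ℝ), |ξ| ≤ 2 ^ k → 𝓕 (schwartzConv (dilate k φ) F) ξ = 𝓕 F ξ := by
    intro k ξ hξ
    rw [hS, hφ1 _ (by rw [habs]; exact div_le_one_of_le₀ hξ (by positivity)), one_mul]
  -- The Frostman condition stops at scale `2^{-n}`. Setting `G k = F` beyond it lets telescoping
  -- sums end exactly at `F`, and the sup bound on `F` keeps the size estimate valid for all `k`.
  let G : ℕ → 𝓢(ℝ, ℂ) := fun k => if k ≤ n then schwartzConv (dilate k φ) F else F
  have hG : ∀ k ≤ n, G k = schwartzConv (dilate k φ) F := fun k hk => if_pos hk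
  have hG' : ∀ k, n < k → G k = F := fun k hk => if_neg (not_le.2 hk)
  have hG1 : ∀ (k : ℕ) (ξ : ℝ), |ξ| ≤ 2 ^ k → 𝓕 (G k) ξ = 𝓕 F ξ := by
    intro k ξ hξ
    by_cases hk : k ≤ n
    · rw [hG k hk, hS1 k ξ hξ]
    · rw [hG' k (not_le.1 hk)]
  have hHr : ∀ k x, schwartzConv (dilate k ψ) F x =
      ((∫ y, 2 ^ k * w (2 ^ k * (x - y)) * f y : ℝ) : ℂ) := by
    intro k x
    rw [schwartzConv_apply_swap, ← integral_complex_ofReal]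
    refine integral_congr_ae (Filter.Eventually.of_forall fun y => ?_)
    simp [dilate_apply, hψw, hF.eq_coe]
  refine ⟨G, fun k => schwartzConv (dilate k ψ) F,
    fun k x => ∫ y, 2 ^ k * w (2 ^ k * (x - y)) * f y, ?_⟩
  refine ⟨fun k hk ξ hξ => ?_, fun k k' hkk ξ hξ => ?_, hG', fun k x => ?_, fun k => ?_, hHr,
    fun k x => integral_nonneg fun y => ?_, fun k ξ hξ => ?_, fun k hk x => ?_, fun k x => ?_,
    fun k hk k' hkk ξ => ?_⟩
  · rw [hG k hk, hS, hφ2 _ (by rw [habs, lt_div_iff₀ (by positivity)]; rw [pow_succ] at hξ; linarith),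
      zero_mul]
  · have h1 : |ξ| ≤ 2 ^ k' := hξ.trans (pow_le_pow_right₀ one_le_two hkk)
    have : 𝓕 (G k' - G k) = 𝓕 (G k') - 𝓕 (G k) := by
      simpa using (FourierTransform.fourierCLM ℂ 𝓢(ℝ, ℂ)).map_sub (G k') (G k)
    rw [this, sub_apply, hG1 k ξ hξ, hG1 k' ξ h1, sub_self]
  · have h2 : 0 < (2 : ℝ) ^ ((k : ℝ) * c) := by positivity
    by_cases hk : k ≤ n
    · rw [hG k hk]
      refine (hDφ c B n F f hF (by linarith) k hk x).trans ?_
      gcongr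
      linarith
    · rw [hG' k (not_le.1 hk), hF.norm_eq]
      refine (hF.le_bound x).trans ?_
      have : (n : ℝ) ≤ k := by exact_mod_cast (not_le.1 hk).le
      gcongr
      · linarith
      · norm_num
  · by_cases hk : k ≤ n
    · rw [hG k hk]
      refine (integral_norm_schwartzConv_le _ _).trans ?_
      rw [integral_norm_dilate]
      nlinarith
    · rw [hG' k (not_le.1 hk)]
      linarith
  · exact mul_nonneg (mul_nonneg (by positivity) (hw _)) (hF.nonneg y)
  · rw [hT, hψ _ (by rw [habs, lt_div_iff₀ (by positivity)]; rw [pow_add] at hξ; linarith),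
      zero_mul]
  · refine (hDψ c B n F f hF (by linarith) k hk x).trans ?_
    gcongr
    linarith
  · have hi : Integrable fun y => 2 ^ k * w (2 ^ k * (x - y)) * f y := by
      -- The integrand is the absolute value of a product of Schwartz functions in `y`, namely `F`
      -- and the reflected translate of the kernel; the conjugation does not affect the norm.
      have h1 := ((schwartzMul ((schwartzConj (dilate k ψ)).compCLMOfContinuousLinearEquiv ℂ
        (ContinuousLinearEquiv.neg ℝ) |>.compSubConstCLM ℂ x) F).integrable (μ := volume)).norm
      refine h1.congr (Filter.Eventually.of_forall fun y => ?_)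
      simp only [schwartzMul_apply]
      simp [schwartzConj_apply, dilate_apply, hψw, hF.norm_eq, abs_of_nonneg (hw _)]
    rw [← integral_const_mul, ← integral_indicator measurableSet_Icc]
    refine integral_mono ?_ hi fun y => ?_
    · exact (hF.integrable.const_mul _).indicator measurableSet_Icc
    · simp only [Set.indicator]
      split_ifs with hy
      · have h2 : |2 ^ k * (x - y)| ≤ δ := by
          rw [abs_mul, abs_of_pos (by positivity : (0 : ℝ) < 2 ^ k)]
          have : |x - y| ≤ δ / 2 ^ k := abs_le.2 ⟨by linarith [hy.2], by linarith [hy.1]⟩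
          calc (2 : ℝ) ^ k * |x - y| ≤ 2 ^ k * (δ / 2 ^ k) := by gcongr
            _ = δ := by field_simp
        have h3 := hwc _ h2
        have := hF.nonneg y
        calc c₁ * 2 ^ k * f y ≤ w (2 ^ k * (x - y)) * 2 ^ k * f y := by gcongr
          _ = _ := by ring
      · exact mul_nonneg (mul_nonneg (by positivity) (hw _)) (hF.nonneg y)
  · rw [hG k hk, hS, hT, ← sub_mul, norm_mul, mul_pow]
    gcongr
    exact multiplier_sq_le hφ1 hφ2 hφ3 hψ0 hψ hC₀ hψ1 hψ2 hkk ξ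

end

/-! ### Hausdorff content and Frostman's lemma on the dyadic tree. -/

noncomputable section

/-- Recognizing the content as an outer measure provides monotonicity and subadditivity. -/
lemma hausdorffContent_eq_ofFunction (s : ℝ) (A : Set ℝ) :
    hausdorffContent s A = OuterMeasure.ofFunction
      (fun U : Set ℝ => ⨆ _ : U.Nonempty, Metric.ediam U ^ s) (by simp) A := by
  rw [OuterMeasure.ofFunction_apply]; rfl

lemma hausdorffContent_union_le (s : ℝ) (A B : Set ℝ) :
    hausdorffContent s (A ∪ B) ≤ hausdorffContent s A + hausdorffContent s B := by
  simp only [hausdorffContent_eq_ofFunction]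
  exact measure_union_le _ _

lemma hausdorffContent_le (s : ℝ) (A : Set ℝ) :
    hausdorffContent s A ≤ ⨆ _ : A.Nonempty, Metric.ediam A ^ s := by
  rw [hausdorffContent_eq_ofFunction]
  exact OuterMeasure.ofFunction_le A

/-- The closed dyadic interval `[j 2^{-k}, (j+1) 2^{-k}]`. -/
def dyadicIcc (k j : ℕ) : Set ℝ := Set.Icc ((j : ℝ) / 2 ^ k) (((j : ℝ) + 1) / 2 ^ k)

lemma dyadicIcc_subset_union (k j : ℕ) :
    dyadicIcc k j ⊆ dyadicIcc (k + 1) (2 * j) ∪ dyadicIcc (k + 1) (2 * j + 1) := by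
  intro x hx
  simp only [dyadicIcc, Set.mem_union, Set.mem_Icc] at hx ⊢
  have e1 : ((2 * j : ℕ) : ℝ) / 2 ^ (k + 1) = j / 2 ^ k := by
    push_cast; rw [pow_succ]; field_simp
  have e2 : (((2 * j + 1 : ℕ) : ℝ) + 1) / 2 ^ (k + 1) = (j + 1) / 2 ^ k := by
    push_cast; rw [pow_succ]; field_simp; ring
  have e3 : (((2 * j : ℕ) : ℝ) + 1) / 2 ^ (k + 1) = ((2 * j + 1 : ℕ) : ℝ) / 2 ^ (k + 1) := by
    push_cast; rfl
  rw [e1, e2, e3]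
  rcases le_total x (((2 * j + 1 : ℕ) : ℝ) / 2 ^ (k + 1)) with h | h
  · exact Or.inl ⟨hx.1, h⟩
  · exact Or.inr ⟨h, hx.2⟩

lemma hausdorffContent_inter_dyadicIcc_le {s τ : ℝ} (hτ : 0 < τ) (hs : τ ≤ s) (A : Set ℝ)
    (k j : ℕ) :
    hausdorffContent s (A ∩ dyadicIcc k j) ≤ ENNReal.ofReal ((2 : ℝ) ^ (-(k : ℝ) * τ)) := by
  refine (hausdorffContent_le s _).trans (iSup_le fun _ => ?_)
  have h1 : Metric.ediam (A ∩ dyadicIcc k j) ≤ ENNReal.ofReal ((2 : ℝ) ^ (-(k : ℝ))) := by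
    refine (Metric.ediam_mono Set.inter_subset_right).trans ?_
    rw [dyadicIcc, Real.ediam_Icc, Real.rpow_neg zero_le_two, Real.rpow_natCast]
    refine ENNReal.ofReal_le_ofReal (le_of_eq ?_)
    field_simp; ring
  calc Metric.ediam (A ∩ dyadicIcc k j) ^ s
      ≤ ENNReal.ofReal ((2 : ℝ) ^ (-(k : ℝ))) ^ s := ENNReal.rpow_le_rpow h1 (hτ.le.trans hs)
    _ = ENNReal.ofReal (((2 : ℝ) ^ (-(k : ℝ))) ^ s) :=
        ENNReal.ofReal_rpow_of_pos (by positivity)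
    _ = ENNReal.ofReal ((2 : ℝ) ^ (-(k : ℝ) * s)) := by rw [← Real.rpow_mul zero_le_two]
    _ ≤ _ := by
        refine ENNReal.ofReal_le_ofReal (Real.rpow_le_rpow_of_exponent_le one_le_two ?_)
        have : (0 : ℝ) ≤ k := Nat.cast_nonneg k
        nlinarith

/-- The indices of the dyadic intervals `e` generations below the interval of index `j`. -/
def dyadicBlock (e j : ℕ) : Finset ℕ := Finset.Ico (j * 2 ^ e) ((j + 1) * 2 ^ e)

lemma mem_dyadicBlock {e j i : ℕ} : i ∈ dyadicBlock e j ↔ i / 2 ^ e = j := by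
  rw [dyadicBlock, Finset.mem_Ico, ← Nat.le_div_iff_mul_le (by positivity),
    ← Nat.div_lt_iff_lt_mul (by positivity)]
  omega

/-- Frostman's lemma on the dyadic tree: a maximal flow below the interval `(k, j)`. -/
lemma exists_tree_weight {s τ : ℝ} (hτ : 0 < τ) (hs : τ ≤ s) (A : Set ℝ) (d : ℕ) :
    ∀ k j : ℕ, ∃ w : ℕ → ℝ, (∀ i, 0 ≤ w i) ∧
      (∀ i, w i ≠ 0 → (A ∩ dyadicIcc (k + d) i).Nonempty) ∧
      (∀ e ≤ d, ∀ j', ∑ i ∈ dyadicBlock e j', w i ≤ (2 : ℝ) ^ (-((k + d : ℝ) - e) * τ)) ∧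
      hausdorffContent s (A ∩ dyadicIcc k j) ≤ ENNReal.ofReal (∑ i ∈ dyadicBlock d j, w i) ∧
      ∀ i, i ∉ dyadicBlock d j → w i = 0 := by
  induction d with
  | zero =>
    intro k j
    classical
    have hb : ∀ j', dyadicBlock 0 j' = {j'} := fun j' => by
      ext i; simp [mem_dyadicBlock]
    refine ⟨fun i => if i = j ∧ (A ∩ dyadicIcc k j).Nonempty then (2 : ℝ) ^ (-(k : ℝ) * τ) else 0,
      fun i => ?_, fun i hi => ?_, fun e he j' => ?_, ?_, fun i hi => ?_⟩
    · dsimp only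
      split_ifs <;> positivity
    · have := (ite_ne_right_iff.1 hi).1
      rw [add_zero, this.1]; exact this.2
    · obtain rfl : e = 0 := by omega
      rw [hb, Finset.sum_singleton]
      split_ifs
      · simp
      · positivity
    · rw [hb, Finset.sum_singleton]
      by_cases h : (A ∩ dyadicIcc k j).Nonempty
      · rw [if_pos ⟨rfl, h⟩]
        exact hausdorffContent_inter_dyadicIcc_le hτ hs A k j
      · refine (hausdorffContent_le s _).trans ?_
        simp [h]
    · rw [hb, Finset.mem_singleton] at hi
      simp [hi]
  | succ d ih =>
    intro k j
    obtain ⟨w₁, h1n, h1s, h1b, h1c, h1z⟩ := ih (k + 1) (2 * j)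
    obtain ⟨w₂, h2n, h2s, h2b, h2c, h2z⟩ := ih (k + 1) (2 * j + 1)
    have hk : k + 1 + d = k + (d + 1) := by ring
    rw [hk] at h1s h2s
    have hdis : ∀ i, i ∈ dyadicBlock (d + 1) j ↔
        i ∈ dyadicBlock d (2 * j) ∨ i ∈ dyadicBlock d (2 * j + 1) := by
      intro i
      simp only [mem_dyadicBlock]
      rw [pow_succ, ← Nat.div_div_eq_div_mul]
      omega
    have hsum : ∑ i ∈ dyadicBlock (d + 1) j, (w₁ i + w₂ i) =
        ∑ i ∈ dyadicBlock d (2 * j), w₁ i + ∑ i ∈ dyadicBlock d (2 * j + 1), w₂ i := by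
      rw [Finset.sum_add_distrib]
      congr 1
      · refine (Finset.sum_subset (fun i hi => (hdis i).2 (Or.inl hi)) fun i _ hi => h1z i hi).symm
      · refine (Finset.sum_subset (fun i hi => (hdis i).2 (Or.inr hi)) fun i _ hi => h2z i hi).symm
    have hblock : ∀ e ≤ d, ∀ j', ∑ i ∈ dyadicBlock e j', (w₁ i + w₂ i) ≤
        (2 : ℝ) ^ (-((k + (d + 1 : ℕ) : ℝ) - e) * τ) := by
      intro e he j'
      have h1 := h1b e he j'
      have h2 := h2b e he j'
      have e1 : ((k + 1 : ℕ) + d : ℝ) = (k + (d + 1 : ℕ) : ℝ) := by push_cast; ring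
      rw [e1] at h1 h2
      -- A block of generation at most `d` lies below a single child of the root, so at most one of
      -- `w₁`, `w₂` charges it and the inductive capacity bound survives addition.
      have hpar : ∀ i ∈ dyadicBlock e j', i / 2 ^ d = j' / 2 ^ (d - e) := by
        intro i hi
        rw [mem_dyadicBlock] at hi
        rw [← hi, Nat.div_div_eq_div_mul, ← pow_add, Nat.add_sub_cancel' he]
      by_cases hj : j' / 2 ^ (d - e) = 2 * j
      · have : ∑ i ∈ dyadicBlock e j', w₂ i = 0 := Finset.sum_eq_zero fun i hi => h2z i (by
          rw [mem_dyadicBlock, hpar i hi]; omega)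
        rw [Finset.sum_add_distrib, this, add_zero]; exact h1
      · have : ∑ i ∈ dyadicBlock e j', w₁ i = 0 := Finset.sum_eq_zero fun i hi => h1z i (by
          rw [mem_dyadicBlock, hpar i hi]; omega)
        rw [Finset.sum_add_distrib, this, zero_add]; exact h2
    have hz : ∀ i, i ∉ dyadicBlock (d + 1) j → w₁ i + w₂ i = 0 := by
      intro i hi
      rw [hdis, not_or] at hi
      rw [h1z i hi.1, h2z i hi.2, add_zero]
    have hsupp : ∀ i, w₁ i + w₂ i ≠ 0 → (A ∩ dyadicIcc (k + (d + 1)) i).Nonempty := by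
      intro i hi
      by_cases h : w₁ i = 0
      · exact h2s i (by intro h'; exact hi (by rw [h, h', add_zero]))
      · exact h1s i h
    set T := ∑ i ∈ dyadicBlock (d + 1) j, (w₁ i + w₂ i) with hT
    have hT0 : 0 ≤ T := Finset.sum_nonneg fun i _ => add_nonneg (h1n i) (h2n i)
    -- The flow is scaled down only if it exceeds the capacity of the root. Unsaturated, it
    -- dominates the content by subadditivity; saturated, it equals the capacity, which bounds the
    -- content of any subset of the interval.
    obtain ⟨θ, hθ0, hθ1, hθT, hθc⟩ : ∃ θ : ℝ, 0 ≤ θ ∧ θ ≤ 1 ∧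
        θ * T ≤ (2 : ℝ) ^ (-(k : ℝ) * τ) ∧
        hausdorffContent s (A ∩ dyadicIcc k j) ≤ ENNReal.ofReal (θ * T) := by
      by_cases hTk : T ≤ (2 : ℝ) ^ (-(k : ℝ) * τ)
      · refine ⟨1, zero_le_one, le_rfl, by rwa [one_mul], ?_⟩
        rw [one_mul, hsum, ENNReal.ofReal_add (Finset.sum_nonneg fun i _ => h1n i)
          (Finset.sum_nonneg fun i _ => h2n i)]
        refine le_trans ?_ ((hausdorffContent_union_le s _ _).trans (add_le_add h1c h2c))
        rw [← Set.inter_union_distrib_left]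
        simp only [hausdorffContent_eq_ofFunction]
        exact measure_mono (Set.inter_subset_inter_right A (dyadicIcc_subset_union k j))
      · push Not at hTk
        have hTpos : 0 < T := lt_trans (by positivity) hTk
        refine ⟨(2 : ℝ) ^ (-(k : ℝ) * τ) / T, by positivity, (div_le_one hTpos).2 hTk.le, ?_, ?_⟩
        · rw [div_mul_cancel₀ _ hTpos.ne']
        · rw [div_mul_cancel₀ _ hTpos.ne']
          exact hausdorffContent_inter_dyadicIcc_le hτ hs A k j
    refine ⟨fun i => θ * (w₁ i + w₂ i), fun i => mul_nonneg hθ0 (add_nonneg (h1n i) (h2n i)),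
      fun i hi => hsupp i (right_ne_zero_of_mul hi), fun e he j' => ?_, ?_,
      fun i hi => by simp [hz i hi]⟩
    · rw [← Finset.mul_sum]
      rcases Nat.lt_or_ge e (d + 1) with he' | he'
      · refine le_trans ?_ (hblock e (by omega) j')
        exact mul_le_of_le_one_left (Finset.sum_nonneg fun i _ => add_nonneg (h1n i) (h2n i)) hθ1
      · obtain rfl : e = d + 1 := by omega
        by_cases hj : j' = j
        · subst hj
          refine hθT.trans (le_of_eq ?_)
          congr 1; ring
        · rw [Finset.sum_eq_zero, mul_zero]
          · positivity
          · intro i hi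
            refine hz i ?_
            rw [mem_dyadicBlock] at hi ⊢
            rwa [hi]
    · rw [← Finset.mul_sum]
      exact hθc

/-- A block decomposition bounds the total weight of the points in a short interval. -/
lemma sum_weight_interval_le {n k : ℕ} (hk : k ≤ n) {w p : ℕ → ℝ} {M : ℝ}
    (hw : ∀ i, 0 ≤ w i) (hp : ∀ i, w i ≠ 0 → p i ∈ dyadicIcc n i)
    (hM : ∀ j, ∑ i ∈ dyadicBlock (n - k) j, w i ≤ M) (S : Finset ℕ) (z : ℝ)
    (hS : ∀ i ∈ S, w i ≠ 0 ∧ p i ∈ Set.Icc z (z + 3 * (2 ^ k)⁻¹)) :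
    ∑ i ∈ S, w i ≤ 5 * M := by
  classical
  -- A point of generation-`k` index `q` in the window satisfies `z 2^k - 1 ≤ q ≤ z 2^k + 3`, which
  -- leaves five consecutive values. Truncation of the ceiling at `0` is harmless because `q` is a
  -- natural number.
  set j₀ := ⌈z * 2 ^ k - 1⌉₊
  have hmaps : ∀ i ∈ S, i / 2 ^ (n - k) ∈ Finset.Icc j₀ (j₀ + 4) := by
    intro i hi
    obtain ⟨hwi, hz1, hz2⟩ := hS i hi
    obtain ⟨h1, h2⟩ := hp i hwi
    set q := i / 2 ^ (n - k) with hq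
    have hn : (2 : ℝ) ^ n = 2 ^ (n - k) * 2 ^ k := by rw [← pow_add, Nat.sub_add_cancel hk]
    have hq1 : q * 2 ^ (n - k) ≤ i := Nat.div_mul_le_self _ _
    have hq2 : i + 1 ≤ (q + 1) * 2 ^ (n - k) := by
      have := Nat.lt_div_mul_add (a := i) (b := 2 ^ (n - k)) (by positivity)
      rw [add_mul, one_mul]; exact this
    have hq1' : (q : ℝ) * 2 ^ (n - k) ≤ i := by exact_mod_cast hq1
    have hq2' : (i : ℝ) + 1 ≤ (q + 1) * 2 ^ (n - k) := by exact_mod_cast hq2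
    have h1' : (q : ℝ) ≤ p i * 2 ^ k := by
      rw [div_le_iff₀ (by positivity), hn] at h1
      have : (q : ℝ) * 2 ^ (n - k) ≤ (p i * 2 ^ k) * 2 ^ (n - k) := by linarith
      exact le_of_mul_le_mul_right this (by positivity)
    have h2' : p i * 2 ^ k ≤ q + 1 := by
      rw [le_div_iff₀ (by positivity), hn] at h2
      have : (p i * 2 ^ k) * 2 ^ (n - k) ≤ (q + 1) * 2 ^ (n - k) := by linarith
      exact le_of_mul_le_mul_right this (by positivity)
    have hz1' : z * 2 ^ k ≤ p i * 2 ^ k := by gcongr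
    have hz2' : p i * 2 ^ k ≤ z * 2 ^ k + 3 := by
      calc p i * 2 ^ k ≤ (z + 3 * (2 ^ k)⁻¹) * 2 ^ k := by gcongr
        _ = _ := by field_simp
    have hj1 : z * 2 ^ k - 1 ≤ (j₀ : ℝ) := Nat.le_ceil _
    rw [Finset.mem_Icc]
    refine ⟨Nat.ceil_le.2 (by linarith), ?_⟩
    have : (q : ℝ) ≤ j₀ + 4 := by linarith
    exact_mod_cast this
  rw [← Finset.sum_fiberwise_of_maps_to hmaps]
  calc ∑ j ∈ Finset.Icc j₀ (j₀ + 4), ∑ i ∈ S with i / 2 ^ (n - k) = j, w i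
      ≤ ∑ j ∈ Finset.Icc j₀ (j₀ + 4), M := by
        refine Finset.sum_le_sum fun j _ => (Finset.sum_le_sum_of_subset_of_nonneg ?_
          fun i _ _ => hw i).trans (hM j)
        intro i hi
        rw [mem_dyadicBlock]
        exact (Finset.mem_filter.1 hi).2
    _ = 5 * M := by
        rw [Finset.sum_const, Nat.card_Icc, nsmul_eq_mul]
        congr 1
        have : j₀ + 4 + 1 - j₀ = 5 := by omega
        rw [this]; norm_num

lemma exists_bump : ∃ (E : 𝓢(ℝ, ℂ)) (ρ : ℝ → ℝ) (D : ℝ), (∀ x, E x = (ρ x : ℂ)) ∧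
    (∀ x, 0 ≤ ρ x) ∧ ∫ x, ρ x = 1 ∧ (∀ x, ρ x ≤ D) ∧ (∀ x, ρ x ≠ 0 → |x| ≤ 1) ∧
    Continuous ρ ∧ Integrable ρ := by
  let b : ContDiffBump (0 : ℝ) := ⟨1 / 2, 1, by norm_num, by norm_num⟩
  have hsm : ContDiff ℝ ((⊤ : ℕ∞) : WithTop ℕ∞) (b.normed volume) := b.contDiff_normed
  have h1 : HasCompactSupport (fun x : ℝ => ((b.normed volume x : ℝ) : ℂ)) :=
    b.hasCompactSupport_normed.comp_left (g := fun r : ℝ => (r : ℂ)) (by simp)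
  have h2 : ContDiff ℝ ((⊤ : ℕ∞) : WithTop ℕ∞) (fun x : ℝ => ((b.normed volume x : ℝ) : ℂ)) :=
    Complex.ofRealCLM.contDiff.comp hsm
  refine ⟨h1.toSchwartzMap h2, b.normed volume, SchwartzMap.seminorm ℝ 0 0 (h1.toSchwartzMap h2),
    fun x => rfl, fun x => b.nonneg_normed x, b.integral_normed, fun x => ?_, fun x hx => ?_,
    hsm.continuous, b.integrable_normed⟩
  · have := SchwartzMap.norm_le_seminorm ℝ (h1.toSchwartzMap h2) x
    refine le_trans ?_ this
    simp only [HasCompactSupport.toSchwartzMap_toFun, Complex.norm_real]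
    exact le_abs_self _
  · have h3 : x ∈ Function.support (b.normed volume) := hx
    rw [b.support_normed_eq] at h3
    simpa [b] using (Metric.mem_ball.1 h3).le

/-- A set of large Hausdorff content carries, at every scale `2^{-n}`, a smooth Frostman density. -/
lemma exists_frostman : ∃ B : ℝ, 1 ≤ B ∧ ∀ (a c s : ℝ) (A : Set ℝ), 0 < c → c < 1 → 1 - c ≤ s →
    A ⊆ Set.Icc 0 1 → ENNReal.ofReal a ≤ hausdorffContent s A →
    ∀ n : ℕ, ∃ (F : 𝓢(ℝ, ℂ)) (f : ℝ → ℝ), IsFrostman c B n F f ∧ a ≤ ∫ x, f x ∧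
      ∀ x, f x ≠ 0 → ∃ p ∈ A, |x - p| ≤ (2 ^ n)⁻¹ := by
  obtain ⟨E, ρ, D, hEρ, hρ0, hρ1, hρD, hρs, hρc, hρi⟩ := exists_bump
  have hD0 : 0 ≤ D := (hρ0 0).trans (hρD 0)
  refine ⟨5 * (D + 1), by linarith, fun a c s A hc hc1 hs hA ha n => ?_⟩
  obtain ⟨w, hw0, hwA, hwb, hwc, hwz⟩ := exists_tree_weight (by linarith : 0 < 1 - c) hs A n 0 0
  have hA0 : A ∩ dyadicIcc 0 0 = A := by
    rw [Set.inter_eq_left]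
    simpa [dyadicIcc] using hA
  rw [hA0] at hwc
  simp only [zero_add] at hwA
  -- The mass of each charged interval is carried by a bump of radius `2^{-n}` centred at a point of
  -- `A`, so the density stays within `2^{-n}` of `A`.
  have hp : ∀ i, ∃ p : ℝ, w i ≠ 0 → p ∈ A ∩ dyadicIcc n i := by
    intro i
    by_cases h : w i = 0
    · exact ⟨0, fun h' => absurd h h'⟩
    · obtain ⟨p, hp⟩ := hwA i h
      exact ⟨p, fun _ => hp⟩
  choose p hp using hp
  set S := (dyadicBlock n 0).filter fun i => w i ≠ 0 with hS
  have hSw : ∀ i ∈ S, w i ≠ 0 := fun i hi => (Finset.mem_filter.1 hi).2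
  have hMk : ∀ k ≤ n, ∀ j, ∑ i ∈ dyadicBlock (n - k) j, w i ≤ (2 : ℝ) ^ (-(k : ℝ) * (1 - c)) := by
    intro k hk j
    have := hwb (n - k) (Nat.sub_le _ _) j
    rw [Nat.cast_sub hk] at this
    simpa using this
  have hnear : ∀ k ≤ n, ∀ (T : Finset ℕ) (z : ℝ),
      (∀ i ∈ T, w i ≠ 0 ∧ p i ∈ Set.Icc z (z + 3 * (2 ^ k)⁻¹)) →
      ∑ i ∈ T, w i ≤ 5 * (2 : ℝ) ^ (-(k : ℝ) * (1 - c)) := fun k hk T z hT =>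
    sum_weight_interval_le hk hw0 (fun i hi => (hp i hi).2) (hMk k hk) T z hT
  have hwsum : ∑ i ∈ S, w i = ∑ i ∈ dyadicBlock n 0, w i := Finset.sum_filter_ne_zero _
  let u : ℕ → ℝ → ℝ := fun i x => 2 ^ n * ρ (2 ^ n * (x - p i))
  have hu0 : ∀ i x, 0 ≤ u i x := fun i x => mul_nonneg (by positivity) (hρ0 _)
  have hus : ∀ i x, u i x ≠ 0 → |x - p i| ≤ (2 ^ n)⁻¹ := by
    intro i x h
    have := hρs _ (right_ne_zero_of_mul h)
    rw [abs_mul, abs_of_pos (by positivity : (0 : ℝ) < 2 ^ n)] at this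
    rwa [← one_div, le_div_iff₀' (by positivity)]
  have hui : ∀ i, Integrable (u i) := fun i =>
    ((hρi.comp_mul_left' (by positivity : (2 : ℝ) ^ n ≠ 0)).comp_sub_right (p i)).const_mul _
  have hu1 : ∀ i, ∫ x, u i x = 1 := by
    intro i
    rw [integral_const_mul, integral_sub_right_eq_self (fun x => ρ (2 ^ n * x)),
      Measure.integral_comp_mul_left ρ, hρ1, abs_of_pos (by positivity), smul_eq_mul, mul_one,
      mul_inv_cancel₀ (by positivity)]
  let f : ℝ → ℝ := fun x => ∑ i ∈ S, w i * u i x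
  have hf : ∀ x, f x = ∑ i ∈ S, w i * u i x := fun x => rfl
  have hf0 : ∀ x, 0 ≤ f x := fun x => Finset.sum_nonneg fun i _ => mul_nonneg (hw0 i) (hu0 i x)
  have hfs : ∀ x, f x ≠ 0 → ∃ p ∈ A, |x - p| ≤ (2 ^ n)⁻¹ := by
    intro x hx
    obtain ⟨i, hi, hne⟩ := Finset.exists_ne_zero_of_sum_ne_zero hx
    exact ⟨p i, (hp i (hSw i hi)).1, hus i x (right_ne_zero_of_mul hne)⟩
  have hfint : ∫ x, f x = ∑ i ∈ dyadicBlock n 0, w i := by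
    rw [← hwsum]
    simp only [hf]
    rw [integral_finsetSum _ fun i _ => (hui i).const_mul _]
    exact Finset.sum_congr rfl fun i _ => by rw [integral_const_mul, hu1, mul_one]
  have hpow : (2 ^ n : ℝ)⁻¹ ≤ 1 := inv_le_one_of_one_le₀ (one_le_pow₀ one_le_two)
  refine ⟨∑ i ∈ S, (w i : ℂ) • (dilate n E).compSubConstCLM ℂ (p i), f,
    ⟨fun x => ?_, hf0, ?_, fun x => ?_, fun k hk z => ?_, fun x hx => ?_⟩, ?_, hfs⟩
  · simp [sum_apply, dilate_apply, hEρ, hf, u]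
  · rw [hfint]
    have := hwb n le_rfl 0
    simpa using this
  · calc f x = ∑ i ∈ S with u i x ≠ 0, w i * u i x := by
          rw [hf]
          refine (Finset.sum_filter_of_ne fun i _ h => right_ne_zero_of_mul h).symm
      _ ≤ ∑ i ∈ S with u i x ≠ 0, w i * (2 ^ n * D) := by
          refine Finset.sum_le_sum fun i _ => mul_le_mul_of_nonneg_left ?_ (hw0 i)
          exact mul_le_mul_of_nonneg_left (hρD _) (by positivity)
      _ = (∑ i ∈ S with u i x ≠ 0, w i) * (2 ^ n * D) := (Finset.sum_mul _ _ _).symm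
      _ ≤ (5 * (2 : ℝ) ^ (-(n : ℝ) * (1 - c))) * (2 ^ n * D) := by
          gcongr
          refine hnear n le_rfl _ (x - (2 ^ n)⁻¹) fun i hi => ?_
          obtain ⟨hi1, hi2⟩ := Finset.mem_filter.1 hi
          have := abs_le.1 (hus i x hi2)
          have h3 : (0 : ℝ) < (2 ^ n)⁻¹ := by positivity
          exact ⟨hSw i hi1, by linarith [this.2], by linarith [this.1]⟩
      _ = 5 * D * (2 : ℝ) ^ ((n : ℝ) * c) := by
          have : (2 : ℝ) ^ ((n : ℝ) * c) = 2 ^ n * (2 : ℝ) ^ (-(n : ℝ) * (1 - c)) := by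
            rw [← Real.rpow_natCast, ← Real.rpow_add two_pos]; congr 1; ring
          rw [this]; ring
      _ ≤ _ := by gcongr; linarith
  · have h1 : ∀ i, ∫ y in Set.Icc z (z + (2 ^ k)⁻¹), u i y ≤ 1 := fun i => by
      rw [← hu1 i]
      exact setIntegral_le_integral (hui i) (Filter.Eventually.of_forall (hu0 i))
    simp only [hf]
    rw [integral_finsetSum _ fun i _ => ((hui i).const_mul _).integrableOn]
    calc ∑ i ∈ S, ∫ y in Set.Icc z (z + (2 ^ k)⁻¹), w i * u i y
        = ∑ i ∈ S, w i * ∫ y in Set.Icc z (z + (2 ^ k)⁻¹), u i y :=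
          Finset.sum_congr rfl fun i _ => integral_const_mul _ _
      _ = ∑ i ∈ S with (∫ y in Set.Icc z (z + (2 ^ k)⁻¹), u i y) ≠ 0,
            w i * ∫ y in Set.Icc z (z + (2 ^ k)⁻¹), u i y :=
          (Finset.sum_filter_of_ne fun i _ h => right_ne_zero_of_mul h).symm
      _ ≤ ∑ i ∈ S with (∫ y in Set.Icc z (z + (2 ^ k)⁻¹), u i y) ≠ 0, w i :=
          Finset.sum_le_sum fun i _ => mul_le_of_le_one_right (hw0 i) (h1 i)
      _ ≤ 5 * (2 : ℝ) ^ (-(k : ℝ) * (1 - c)) := by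
          -- A bump meeting the interval has its centre within `2^{-n} ≤ 2^{-k}` of it, so the
          -- centres lie in a window of length `3 · 2^{-k}`.
          refine hnear k hk _ (z - (2 ^ k)⁻¹) fun i hi => ?_
          obtain ⟨hi1, hi2⟩ := Finset.mem_filter.1 hi
          refine ⟨hSw i hi1, ?_⟩
          obtain ⟨y, hy, hyu⟩ : ∃ y ∈ Set.Icc z (z + (2 ^ k)⁻¹), u i y ≠ 0 := by
            by_contra! hcon
            exact hi2 (setIntegral_eq_zero_of_forall_eq_zero hcon)
          have h2 := abs_le.1 (hus i y hyu)
          have h3 : (2 ^ n : ℝ)⁻¹ ≤ (2 ^ k)⁻¹ :=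
            inv_anti₀ (by positivity) (pow_le_pow_right₀ one_le_two hk)
          exact ⟨by linarith [hy.1, h2.2], by linarith [hy.2, h2.1]⟩
      _ ≤ _ := by gcongr; linarith
  · obtain ⟨q, hq, hxq⟩ := hfs x hx
    have h2 := abs_le.1 hxq
    have h3 := hA hq
    exact ⟨by linarith [h3.1, h2.1], by linarith [h3.2, h2.2]⟩
  · rw [hfint]
    have h4 : ENNReal.ofReal a ≤ ENNReal.ofReal (∑ i ∈ dyadicBlock n 0, w i) := ha.trans hwc
    exact (ENNReal.ofReal_le_ofReal_iff (Finset.sum_nonneg fun i _ => hw0 i)).1 h4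

end

/-! ### The counting form and its basic estimates. -/

noncomputable section

/-- The measure `dx dt` on `ℝ × (0, 1]`. -/
def stripMeasure : Measure (ℝ × ℝ) := volume.prod (volume.restrict (Set.Ioc (0 : ℝ) 1))

/-- The integrand `g₀(x) ∏ i, g i (x - P i (2^{-l} t))`. -/
def progIntegrand {m : ℕ} (P : Fin m → ℝ[X]) (l : ℕ) (g₀ : 𝓢(ℝ, ℂ)) (g : Fin m → 𝓢(ℝ, ℂ))
    (z : ℝ × ℝ) : ℂ := g₀ z.1 * ∏ i, g i (z.1 - (P i).eval (z.2 / 2 ^ l))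

/-- The multilinear form counting progressions at scale `2^{-l}`. -/
def progForm {m : ℕ} (P : Fin m → ℝ[X]) (l : ℕ) (g₀ : 𝓢(ℝ, ℂ)) (g : Fin m → 𝓢(ℝ, ℂ)) : ℂ :=
  ∫ z, progIntegrand P l g₀ g z ∂stripMeasure

variable {m : ℕ} {P : Fin m → ℝ[X]} {l : ℕ} {g₀ : 𝓢(ℝ, ℂ)} {g : Fin m → 𝓢(ℝ, ℂ)}

instance : IsProbabilityMeasure (volume.restrict (Set.Ioc (0 : ℝ) 1)) := ⟨by simp⟩

lemma exists_norm_bound (f : 𝓢(ℝ, ℂ)) : ∃ b : ℝ, 0 ≤ b ∧ ∀ x, ‖f x‖ ≤ b :=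
  ⟨_, apply_nonneg _ _, fun x => SchwartzMap.norm_le_seminorm ℝ f x⟩

lemma continuous_progIntegrand : Continuous (progIntegrand P l g₀ g) := by
  unfold progIntegrand
  refine (g₀.continuous.comp continuous_fst).mul (continuous_finsetProd _ fun i _ => ?_)
  exact (g i).continuous.comp (continuous_fst.sub ((P i).continuous.comp
    (continuous_snd.div_const _)))

lemma integrable_progIntegrand : Integrable (progIntegrand P l g₀ g) stripMeasure := by
  choose b hb0 hb using fun i => exists_norm_bound (g i)
  have h1 : Integrable (fun z : ℝ × ℝ => ‖g₀ z.1‖ * ∏ i, b i) stripMeasure :=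
    (Integrable.comp_fst (g₀.integrable (μ := volume)).norm _).mul_const _
  refine h1.mono' continuous_progIntegrand.aestronglyMeasurable
    (Filter.Eventually.of_forall fun z => ?_)
  rw [progIntegrand, norm_mul, norm_prod]
  gcongr
  exact hb _ _

lemma integrable_progIntegrand_slice (t : ℝ) :
    Integrable (fun x => progIntegrand P l g₀ g (x, t)) := by
  choose b hb0 hb using fun i => exists_norm_bound (g i)
  have h1 : Integrable (fun x : ℝ => ‖g₀ x‖ * ∏ i, b i) :=
    (g₀.integrable (μ := volume)).norm.mul_const _
  refine h1.mono' (continuous_progIntegrand.comp (by fun_prop)).aestronglyMeasurable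
    (Filter.Eventually.of_forall fun z => ?_)
  simp only [progIntegrand, norm_mul, norm_prod]
  gcongr
  exact hb _ _

lemma progForm_eq_average :
    progForm P l g₀ g = ∫ x, g₀ x * polyAverage P l (fun i => (g i : ℝ → ℂ)) x := by
  rw [progForm, stripMeasure, integral_prod _ integrable_progIntegrand]
  refine integral_congr_ae (Filter.Eventually.of_forall fun x => ?_)
  simp only [progIntegrand, polyAverage]
  rw [integral_const_mul, intervalIntegral.integral_of_le zero_le_one]

lemma progForm_eq_iterated :
    progForm P l g₀ g = ∫ t in Set.Ioc (0 : ℝ) 1, ∫ x, progIntegrand P l g₀ g (x, t) := by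
  rw [progForm, stripMeasure, integral_prod_symm _ integrable_progIntegrand]

lemma norm_progForm_le_of_slice {M : ℝ}
    (h : ∀ t ∈ Set.Ioc (0 : ℝ) 1, ‖∫ x, progIntegrand P l g₀ g (x, t)‖ ≤ M) :
    ‖progForm P l g₀ g‖ ≤ M := by
  rw [progForm_eq_iterated]
  have := norm_setIntegral_le_of_norm_le_const (μ := volume) (s := Set.Ioc (0 : ℝ) 1)
    (by simp) h
  simpa using this

lemma progForm_sub_left (u v : 𝓢(ℝ, ℂ)) :
    progForm P l (u - v) g = progForm P l u g - progForm P l v g := by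
  rw [progForm, progForm, progForm, ← integral_sub integrable_progIntegrand integrable_progIntegrand]
  refine integral_congr_ae (Filter.Eventually.of_forall fun z => ?_)
  simp only [progIntegrand, sub_apply]
  ring

lemma progForm_update_sub (i : Fin m) (u v : 𝓢(ℝ, ℂ)) :
    progForm P l g₀ (Function.update g i (u - v)) =
      progForm P l g₀ (Function.update g i u) - progForm P l g₀ (Function.update g i v) := by
  rw [progForm, progForm, progForm, ← integral_sub integrable_progIntegrand integrable_progIntegrand]
  refine integral_congr_ae (Filter.Eventually.of_forall fun z => ?_)
  have key : ∀ w : 𝓢(ℝ, ℂ), ∏ j, Function.update g i w j (z.1 - (P j).eval (z.2 / 2 ^ l)) =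
      w (z.1 - (P i).eval (z.2 / 2 ^ l)) *
        ∏ j ∈ Finset.univ.erase i, g j (z.1 - (P j).eval (z.2 / 2 ^ l)) := by
    intro w
    rw [← Finset.mul_prod_erase _ _ (Finset.mem_univ i), Function.update_self]
    congr 1
    refine Finset.prod_congr rfl fun j hj => ?_
    rw [Function.update_of_ne (Finset.ne_of_mem_erase hj)]
  simp only [progIntegrand, key, sub_apply]
  ring

lemma progForm_eq_zero_of_freq (hm : 1 ≤ m) {R : ℝ} (h₀ : HighFreq (m * R) g₀)
    (hg : ∀ i, LowFreq R (g i)) : progForm P l g₀ g = 0 := by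
  rw [progForm_eq_iterated]
  refine integral_eq_zero_of_ae (Filter.Eventually.of_forall fun t => ?_)
  exact integral_mul_prod_eq_zero hm h₀ hg fun i => (P i).eval (t / 2 ^ l)

lemma norm_progForm_le_trivial {b : ℝ} (hb : ∀ i x, ‖g i x‖ ≤ b) :
    ‖progForm P l g₀ g‖ ≤ (∫ x, ‖g₀ x‖) * b ^ m := by
  refine norm_progForm_le_of_slice fun t _ => ?_
  rw [← integral_mul_const]
  refine norm_integral_le_of_norm_le ((g₀.integrable (μ := volume)).norm.mul_const _)
    (Filter.Eventually.of_forall fun x => ?_)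
  simp only [progIntegrand, norm_mul, norm_prod]
  gcongr
  calc ∏ i, ‖g i (x - (P i).eval (t / 2 ^ l))‖ ≤ ∏ _i : Fin m, b :=
        Finset.prod_le_prod (fun _ _ => norm_nonneg _) fun i _ => hb i _
    _ = b ^ m := by simp

lemma integrable_norm_sq (f : 𝓢(ℝ, ℂ)) : Integrable fun x => ‖f x‖ ^ 2 := by
  refine ((schwartzMul f f).integrable (μ := volume)).norm.congr
    (Filter.Eventually.of_forall fun x => ?_)
  simp only [schwartzMul_apply, norm_mul]
  ring

/-- All factors but `g₀` and `g i` are bounded in sup norm; the weighted inequality `AD ≤ η A² + η⁻¹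
D²` replaces Cauchy–Schwarz, with `η` left free for balancing against the energy. -/
lemma norm_progForm_le_sq (i : Fin m) {b η : ℝ} (hη : 0 < η) (hb0 : 0 ≤ b)
    (hb : ∀ j, j ≠ i → ∀ x, ‖g j x‖ ≤ b) :
    ‖progForm P l g₀ g‖ ≤
      b ^ (m - 1) * (η * (∫ x, ‖g₀ x‖ ^ 2) + η⁻¹ * ∫ x, ‖g i x‖ ^ 2) := by
  refine norm_progForm_le_of_slice fun t _ => ?_
  set s := (P i).eval (t / 2 ^ l) with hs
  have hi : Integrable fun x => ‖g i (x - s)‖ ^ 2 := (integrable_norm_sq (g i)).comp_sub_right s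
  have e : ∫ x, ‖g i x‖ ^ 2 = ∫ x, ‖g i (x - s)‖ ^ 2 :=
    (integral_sub_right_eq_self (fun x => ‖g i x‖ ^ 2) s).symm
  rw [e, ← integral_const_mul, ← integral_const_mul, ← integral_add
    ((integrable_norm_sq g₀).const_mul _) (hi.const_mul _), ← integral_const_mul]
  refine norm_integral_le_of_norm_le ((((integrable_norm_sq g₀).const_mul _).add
    (hi.const_mul _)).const_mul _) (Filter.Eventually.of_forall fun x => ?_)
  simp only [progIntegrand, norm_mul, norm_prod]
  rw [← Finset.mul_prod_erase _ _ (Finset.mem_univ i), ← hs]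
  have h1 : ∏ j ∈ Finset.univ.erase i, ‖g j (x - (P j).eval (t / 2 ^ l))‖ ≤ b ^ (m - 1) := by
    calc ∏ j ∈ Finset.univ.erase i, ‖g j (x - (P j).eval (t / 2 ^ l))‖
        ≤ ∏ _j ∈ Finset.univ.erase i, b :=
          Finset.prod_le_prod (fun _ _ => norm_nonneg _) fun j hj =>
            hb j (Finset.ne_of_mem_erase hj) _
      _ = b ^ (m - 1) := by simp
  set A := ‖g₀ x‖
  set D := ‖g i (x - s)‖
  have hA : 0 ≤ A := norm_nonneg _
  have hD : 0 ≤ D := norm_nonneg _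
  have h2 : A * D ≤ η * A ^ 2 + η⁻¹ * D ^ 2 := by
    have h3 : 0 ≤ η * (A - η⁻¹ * D) ^ 2 := by positivity
    have h4 : η * (A - η⁻¹ * D) ^ 2 = η * A ^ 2 + η⁻¹ * D ^ 2 - 2 * (A * D) := by
      field_simp; ring
    nlinarith [mul_nonneg hA hD]
  calc A * (D * ∏ j ∈ Finset.univ.erase i, ‖g j (x - (P j).eval (t / 2 ^ l))‖)
      ≤ A * (D * b ^ (m - 1)) := by gcongr
    _ = b ^ (m - 1) * (A * D) := by ring
    _ ≤ _ := by gcongr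

/-- Interpolation between `L¹` and `L^∞`: `|f|^m ≤ b^{m-1} |f|`. -/
lemma eLpNorm_natCast_le (hm : 1 ≤ m) {f : 𝓢(ℝ, ℂ)} {b : ℝ}
    (hb : ∀ x, ‖f x‖ ≤ b) (hb1 : ∫ x, ‖f x‖ ≤ b) :
    eLpNorm (f : ℝ → ℂ) (m : ℝ≥0∞) volume ≤ ENNReal.ofReal b := by
  have hm0 : (m : ℝ≥0∞) ≠ 0 := by simp; omega
  have hmr : (0 : ℝ) < m := by exact_mod_cast hm
  rw [eLpNorm_eq_lintegral_rpow_enorm_toReal hm0 (by simp)]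
  rw [ENNReal.toReal_natCast, one_div, ENNReal.rpow_inv_le_iff hmr, ENNReal.rpow_natCast]
  calc ∫⁻ x, ‖f x‖ₑ ^ (m : ℝ) ≤ ∫⁻ x, ENNReal.ofReal b ^ (m - 1) * ‖f x‖ₑ := by
        refine lintegral_mono fun x => ?_
        have e : m = (m - 1) + 1 := by omega
        rw [ENNReal.rpow_natCast]
        conv_lhs => rw [e, pow_succ]
        gcongr
        rw [← ofReal_norm]
        exact ENNReal.ofReal_le_ofReal (hb x)
    _ = ENNReal.ofReal b ^ (m - 1) * ∫⁻ x, ‖f x‖ₑ :=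
        lintegral_const_mul' _ _ (by finiteness)
    _ ≤ ENNReal.ofReal b ^ (m - 1) * ENNReal.ofReal b := by
        gcongr
        rw [← ofReal_integral_norm_eq_lintegral_enorm f.integrable]
        exact ENNReal.ofReal_le_ofReal hb1
    _ = ENNReal.ofReal b ^ m := by
        rw [← pow_succ]; congr 1; omega

/-- The form pairs `g₀` with the average, so the `L¹` bound for the average is used against the sup
norm of `g₀`. -/
lemma norm_progForm_le_of_sobolev (hm : 1 ≤ m) {σ C : ℝ} (hE : SobolevEstimate P σ C)
    (hl : C ≤ l) {N : ℝ} (hN : 1 ≤ N) (i : Fin m)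
    (hi : HighFreq (N * 2 ^ (l * vanishingOrder (P i))) (g i)) {b₀ b : ℝ}
    (hb₀ : ∀ x, ‖g₀ x‖ ≤ b₀) (hb0 : 0 ≤ b) (hb : ∀ j x, ‖g j x‖ ≤ b)
    (hb1 : ∀ j, ∫ x, ‖g j x‖ ≤ b) :
    ‖progForm P l g₀ g‖ ≤ b₀ * (C * N ^ (-σ)) * b ^ m := by
  obtain ⟨hσ, hσC, hest⟩ := hE
  have h := hest l hl N hN g ⟨i, fun ξ hξ => hi ξ hξ⟩
  have hb₀0 : 0 ≤ b₀ := (norm_nonneg _).trans (hb₀ 0)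
  have hCN : 0 ≤ C * N ^ (-σ) := mul_nonneg (by linarith) (Real.rpow_nonneg (by linarith) _)
  have h2 : eLpNorm (polyAverage P l fun i => (g i : ℝ → ℂ)) 1 volume ≤
      ENNReal.ofReal (C * N ^ (-σ) * b ^ m) := by
    refine h.trans ?_
    rw [ENNReal.ofReal_mul hCN, ENNReal.ofReal_pow hb0]
    gcongr
    calc ∏ j, eLpNorm (g j : ℝ → ℂ) (m : ℝ≥0∞) volume ≤ ∏ _j : Fin m, ENNReal.ofReal b :=
          Finset.prod_le_prod (fun _ _ => zero_le) fun j _ =>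
            eLpNorm_natCast_le hm (hb j) (hb1 j)
      _ = _ := by simp
  rw [eLpNorm_one_eq_lintegral_enorm] at h2
  have h3 : ‖progForm P l g₀ g‖ₑ ≤ ENNReal.ofReal (b₀ * (C * N ^ (-σ)) * b ^ m) := by
    rw [progForm_eq_average]
    refine (enorm_integral_le_lintegral_enorm _).trans ?_
    calc ∫⁻ x, ‖g₀ x * polyAverage P l (fun i => (g i : ℝ → ℂ)) x‖ₑ
        ≤ ∫⁻ x, ENNReal.ofReal b₀ * ‖polyAverage P l (fun i => (g i : ℝ → ℂ)) x‖ₑ := by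
          refine lintegral_mono fun x => ?_
          rw [enorm_mul]
          gcongr
          rw [← ofReal_norm]
          exact ENNReal.ofReal_le_ofReal (hb₀ x)
      _ = ENNReal.ofReal b₀ * ∫⁻ x, ‖polyAverage P l (fun i => (g i : ℝ → ℂ)) x‖ₑ :=
          lintegral_const_mul' _ _ (by finiteness)
      _ ≤ ENNReal.ofReal b₀ * ENNReal.ofReal (C * N ^ (-σ) * b ^ m) := by gcongr
      _ = _ := by rw [← ENNReal.ofReal_mul hb₀0, mul_assoc b₀]
  rw [← ofReal_norm] at h3
  exact (ENNReal.ofReal_le_ofReal_iff (by positivity)).1 h3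

/-- Replacing the arguments of a function of `m` variables one at a time. -/
lemma norm_sub_le_of_hybrid {X : Type*} (T : (Fin m → X) → ℂ) (u v : Fin m → X) (δ : Fin m → ℝ)
    (h : ∀ i, ∀ g : Fin m → X, (∀ j, g j = u j ∨ g j = v j) →
      ‖T (Function.update g i (u i)) - T (Function.update g i (v i))‖ ≤ δ i) :
    ‖T u - T v‖ ≤ ∑ i, δ i := by
  classical
  have key : ∀ s : Finset (Fin m), ‖T (s.piecewise u v) - T v‖ ≤ ∑ i ∈ s, δ i := by
    intro s
    induction s using Finset.induction_on with
    | empty => simp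
    | insert a s ha ih =>
      rw [Finset.sum_insert ha, Finset.piecewise_insert]
      have h1 := h a (s.piecewise u v) fun j => by
        by_cases hj : j ∈ s
        · exact Or.inl (Finset.piecewise_eq_of_mem _ _ _ hj)
        · exact Or.inr (Finset.piecewise_eq_of_notMem _ _ _ hj)
      have h2 : Function.update (s.piecewise u v) a (v a) = s.piecewise u v := by
        rw [← Finset.piecewise_eq_of_notMem s u v ha, Function.update_eq_self]
      rw [h2] at h1
      calc ‖T (Function.update (s.piecewise u v) a (u a)) - T v‖
          ≤ ‖T (Function.update (s.piecewise u v) a (u a)) - T (s.piecewise u v)‖ +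
            ‖T (s.piecewise u v) - T v‖ := norm_sub_le_norm_sub_add_norm_sub _ _ _
        _ ≤ _ := add_le_add h1 ih
  simpa using key Finset.univ

lemma norm_progForm_sub_le {u v : Fin m → 𝓢(ℝ, ℂ)} {δ : Fin m → ℝ}
    (h : ∀ i, ∀ g : Fin m → 𝓢(ℝ, ℂ), g i = u i - v i → (∀ j, j ≠ i → g j = u j ∨ g j = v j) →
      ‖progForm P l g₀ g‖ ≤ δ i) :
    ‖progForm P l g₀ u - progForm P l g₀ v‖ ≤ ∑ i, δ i := by
  refine norm_sub_le_of_hybrid (progForm P l g₀) u v δ fun i g hg => ?_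
  rw [← progForm_update_sub]
  refine h i _ (Function.update_self _ _ _) fun j hj => ?_
  rw [Function.update_of_ne hj]
  exact hg j

end

/-! ### Removing high frequencies with the Sobolev estimate. -/

noncomputable section

variable {m : ℕ} {P : Fin m → ℝ[X]} {l : ℕ}
  {c B δ c₁ C₀ : ℝ} {n : ℕ} {F : 𝓢(ℝ, ℂ)} {f : ℝ → ℝ} {G H : ℕ → 𝓢(ℝ, ℂ)} {h : ℕ → ℝ → ℝ}

lemma ScaleFamily.norm_diff_le (sf : ScaleFamily c B δ c₁ C₀ n F f G H h) (hB : 1 ≤ B) (hc : 0 ≤ c)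
    {j k K : ℕ} (hj : j ≤ K) (hk : k ≤ K) (x : ℝ) :
    ‖(G k - G j) x‖ ≤ 2 * B * (2 : ℝ) ^ ((K : ℝ) * c) := by
  have h1 : ∀ i ≤ K, ‖G i x‖ ≤ B * (2 : ℝ) ^ ((K : ℝ) * c) := by
    intro i hi
    refine (sf.norm_le i x).trans ?_
    have : (i : ℝ) ≤ K := by exact_mod_cast hi
    gcongr
    norm_num
  rw [sub_apply]
  refine (norm_sub_le _ _).trans ?_
  linarith [h1 j hj, h1 k hk]

lemma integral_norm_sub_le (u v : 𝓢(ℝ, ℂ)) :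
    ∫ x, ‖(u - v) x‖ ≤ (∫ x, ‖u x‖) + ∫ x, ‖v x‖ := by
  rw [← integral_add u.integrable.norm v.integrable.norm]
  refine integral_mono (u - v).integrable.norm (u.integrable.norm.add v.integrable.norm) fun x => ?_
  rw [sub_apply]
  exact norm_sub_le _ _

lemma ScaleFamily.norm_le_two (sf : ScaleFamily c B δ c₁ C₀ n F f G H h) (hB : 1 ≤ B) (hc : 0 ≤ c)
    {k K : ℕ} (hk : k ≤ K) (x : ℝ) : ‖G k x‖ ≤ 2 * B * (2 : ℝ) ^ ((K : ℝ) * c) := by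
  refine (sf.norm_le k x).trans ?_
  have : (k : ℝ) ≤ K := by exact_mod_cast hk
  gcongr
  · linarith
  · norm_num

/-- Sobolev bound for the form with one entry a difference of Littlewood–Paley approximations and
the others such approximations. -/
lemma ScaleFamily.norm_progForm_le (hm : 1 ≤ m) {σ C : ℝ} (hE : SobolevEstimate P σ C)
    (hl : C ≤ l) (sf : ScaleFamily c B δ c₁ C₀ n F f G H h) (hB : 1 ≤ B) (hc : 0 ≤ c)
    {K k₀ ν : ℕ} (i : Fin m) {k k' : ℕ} (hkk : k ≤ k') (hk' : k' ≤ K)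
    (hν : l * vanishingOrder (P i) + ν ≤ k) {g : Fin m → 𝓢(ℝ, ℂ)} (hgi : g i = G k' - G k)
    (hg : ∀ j, j ≠ i → ∃ q ≤ K, g j = G q) :
    ‖progForm P l (G k₀) g‖ ≤ B * (2 : ℝ) ^ ((k₀ : ℝ) * c) * (C * (2 : ℝ) ^ (-(ν : ℝ) * σ)) *
      (2 * B * (2 : ℝ) ^ ((K : ℝ) * c)) ^ m := by
  have h1K : 1 ≤ (2 : ℝ) ^ ((K : ℝ) * c) := Real.one_le_rpow one_le_two (by positivity)
  have key := norm_progForm_le_of_sobolev (g₀ := G k₀) (g := g) hm hE hl (N := 2 ^ ν)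
    (one_le_pow₀ one_le_two) i (b₀ := B * (2 : ℝ) ^ ((k₀ : ℝ) * c))
    (b := 2 * B * (2 : ℝ) ^ ((K : ℝ) * c)) ?_ (sf.norm_le k₀) (by positivity) ?_ ?_
  · refine key.trans (le_of_eq ?_)
    congr 3
    rw [← Real.rpow_natCast, ← Real.rpow_mul zero_le_two]
    ring_nf
  · rw [hgi]
    refine (sf.high k k' hkk).mono ?_
    rw [← pow_add]
    exact pow_le_pow_right₀ one_le_two (by omega)
  · intro j x
    by_cases hj : j = i
    · subst hj
      rw [hgi]
      exact sf.norm_diff_le hB hc (hkk.trans hk') hk' x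
    · obtain ⟨q, hq, hgq⟩ := hg j hj
      rw [hgq]
      exact sf.norm_le_two hB hc hq x
  · intro j
    by_cases hj : j = i
    · subst hj
      rw [hgi]
      refine (integral_norm_sub_le _ _).trans ?_
      have h2 := sf.integral_norm_le k
      have h3 := sf.integral_norm_le k'
      nlinarith
    · obtain ⟨q, hq, hgq⟩ := hg j hj
      rw [hgq]
      have h2 := sf.integral_norm_le q
      nlinarith

/-- The constant in `ScaleFamily.tail_le`. -/
def tailConst (m r : ℕ) (σ C B : ℝ) : ℝ :=
  m * (B * C * (2 * B) ^ m * 2 ^ (1 + r + m)) / (1 - (2 : ℝ) ^ (-(σ / 4)))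

lemma tailConst_nonneg {m r : ℕ} {σ C B : ℝ} (hσ : 0 < σ) (hC : 0 < C) (hB : 1 ≤ B) :
    0 ≤ tailConst m r σ C B := by
  have hq1 : (2 : ℝ) ^ (-(σ / 4)) < 1 :=
    Real.rpow_lt_one_of_one_lt_of_neg one_lt_two (by linarith)
  exact div_nonneg (by positivity) (by linarith)

/-- Frequencies beyond `2^{k₀}` contribute little to the counting form. -/
lemma ScaleFamily.tail_le (hm : 1 ≤ m) {σ C : ℝ} (hE : SobolevEstimate P σ C) (hl : C ≤ l)
    (sf : ScaleFamily c B δ c₁ C₀ n F f G H h) (hB : 1 ≤ B) (hc : 0 ≤ c) (hc1 : c ≤ 1)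
    (hcσ : c * (m + 1) ≤ σ / 4) {r : ℕ} (hr : 2 * m ≤ 2 ^ r) {k₀ : ℕ}
    (hk₀ : ∀ i, 2 * (l * vanishingOrder (P i)) ≤ k₀) (hk₀n : k₀ ≤ n) :
    ‖progForm P l F (fun _ => F) - progForm P l (G (k₀ + r)) (fun _ => G k₀)‖ ≤
      tailConst m r σ C B * (2 : ℝ) ^ (-(k₀ : ℝ) * (σ / 4)) := by
  have hσ := hE.1
  have hC : 0 < C := hE.1.trans hE.2.1
  set q : ℝ := (2 : ℝ) ^ (-(σ / 4)) with hq
  have hq0 : 0 < q := by positivity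
  have hq1 : q < 1 := Real.rpow_lt_one_of_one_lt_of_neg one_lt_two (by linarith)
  have hqk : ∀ k : ℕ, q ^ k = (2 : ℝ) ^ (-(k : ℝ) * (σ / 4)) := fun k => by
    rw [hq, ← Real.rpow_natCast, ← Real.rpow_mul zero_le_two]; congr 1; ring
  -- The last factor absorbs the part of the Frostman loss not growing with `k`, whose exponent is
  -- `c (1 + r + m) ≤ 1 + r + m`.
  set E₀ : ℝ := B * C * (2 * B) ^ m * 2 ^ (1 + r + m) with hE₀
  -- The first entry runs `r` scales ahead of the others. With `2m ≤ 2^r`, frequencies of the first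
  -- entry above `2^{k+r}` are orthogonal to a product of `m` functions of frequency at most
  -- `2^{k+1}`, so advancing that entry costs nothing and its sup norm stays `O(2^{kc})`.
  set T : ℕ → ℂ := fun k => progForm P l (G (k + r)) (fun _ => G k) with hT
  have hTn : T (n + 1) = progForm P l F (fun _ => F) := by
    simp only [hT]
    rw [sf.eq_of_lt (n + 1) (by omega), sf.eq_of_lt (n + 1 + r) (by omega)]
  have step : ∀ k ∈ Finset.Ico k₀ (n + 1), ‖T (k + 1) - T k‖ ≤ m * E₀ * q ^ k := by
    intro k hk
    rw [Finset.mem_Ico] at hk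
    have hzero : progForm P l (G (k + 1 + r)) (fun _ => G k) = T k := by
      rw [← sub_eq_zero, ← progForm_sub_left]
      refine progForm_eq_zero_of_freq hm (R := 2 ^ (k + 1)) ?_ fun _ => sf.low k (by omega)
      refine (sf.high (k + r) (k + 1 + r) (by omega)).mono ?_
      have : (2 * m : ℝ) ≤ 2 ^ r := by exact_mod_cast hr
      calc (m : ℝ) * 2 ^ (k + 1) = 2 ^ k * (2 * m) := by ring
        _ ≤ 2 ^ k * 2 ^ r := by gcongr
        _ = 2 ^ (k + r) := (pow_add _ _ _).symm
    have hδ : ∀ i : Fin m, ∀ g : Fin m → 𝓢(ℝ, ℂ), g i = G (k + 1) - G k →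
        (∀ j, j ≠ i → g j = G (k + 1) ∨ g j = G k) →
        ‖progForm P l (G (k + 1 + r)) g‖ ≤ E₀ * q ^ k := by
      intro i g hgi hg
      have hle := hk₀ i
      -- As `k ≥ 2 l e_i`, the excess `ν` is at least `k / 2`: the gain `2^{-kσ/2}` outweighs the
      -- loss `2^{kc(m+1)} ≤ 2^{kσ/4}`, leaving the geometric ratio `2^{-σ/4}`.
      set ν := k - l * vanishingOrder (P i) with hν
      have key := sf.norm_progForm_le hm hE hl hB hc (K := k + 1) (k₀ := k + 1 + r) (ν := ν) i
        (k := k) (k' := k + 1) (by omega) le_rfl (by omega) hgi fun j hj => by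
          rcases hg j hj with h1 | h1
          · exact ⟨k + 1, le_rfl, h1⟩
          · exact ⟨k, by omega, h1⟩
      refine key.trans ?_
      have hν2 : (k : ℝ) / 2 ≤ ν := by
        have : k ≤ 2 * ν := by omega
        have : (k : ℝ) ≤ 2 * ν := by exact_mod_cast this
        linarith
      have e1 : (2 * B * (2 : ℝ) ^ (((k + 1 : ℕ) : ℝ) * c)) ^ m =
          (2 * B) ^ m * (2 : ℝ) ^ (((k + 1 : ℕ) : ℝ) * c * m) := by
        rw [mul_pow, ← Real.rpow_natCast ((2 : ℝ) ^ _), ← Real.rpow_mul zero_le_two]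
      rw [e1, hqk, hE₀, ← Real.rpow_natCast 2 (1 + r + m)]
      have e2 : B * (2 : ℝ) ^ (((k + 1 + r : ℕ) : ℝ) * c) * (C * (2 : ℝ) ^ (-(ν : ℝ) * σ)) *
          ((2 * B) ^ m * (2 : ℝ) ^ (((k + 1 : ℕ) : ℝ) * c * m)) =
          B * C * (2 * B) ^ m * (2 : ℝ) ^ (((k + 1 + r : ℕ) : ℝ) * c + -(ν : ℝ) * σ +
            ((k + 1 : ℕ) : ℝ) * c * m) := by
        rw [Real.rpow_add two_pos, Real.rpow_add two_pos]; ring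
      rw [e2, mul_assoc (B * C * (2 * B) ^ m), ← Real.rpow_add two_pos]
      refine mul_le_mul_of_nonneg_left (Real.rpow_le_rpow_of_exponent_le one_le_two ?_)
        (by positivity)
      push_cast
      have hk0 : (0 : ℝ) ≤ k := Nat.cast_nonneg k
      have hr0 : (0 : ℝ) ≤ r := Nat.cast_nonneg r
      have hm0 : (0 : ℝ) ≤ m := Nat.cast_nonneg m
      have t1 : (k : ℝ) * (c * (m + 1)) ≤ k * (σ / 4) := by gcongr
      have t2 : c * (1 + r + m) ≤ 1 * (1 + r + m) := by gcongr
      have t3 : (k : ℝ) / 2 * σ ≤ ν * σ := by gcongr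
      nlinarith
    have h1 := norm_progForm_sub_le (P := P) (l := l) (g₀ := G (k + 1 + r))
      (u := fun _ => G (k + 1)) (v := fun _ => G k) (δ := fun _ => E₀ * q ^ k) hδ
    rw [hzero] at h1
    refine h1.trans (le_of_eq ?_)
    simp; ring
  have hsum : T (n + 1) - T k₀ = ∑ k ∈ Finset.Ico k₀ (n + 1), (T (k + 1) - T k) :=
    (Finset.sum_Ico_sub T (by omega)).symm
  rw [← hTn, hsum]
  calc ‖∑ k ∈ Finset.Ico k₀ (n + 1), (T (k + 1) - T k)‖
      ≤ ∑ k ∈ Finset.Ico k₀ (n + 1), m * E₀ * q ^ k := norm_sum_le_of_le _ step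
    _ = m * E₀ * ∑ k ∈ Finset.Ico k₀ (n + 1), q ^ k := (Finset.mul_sum _ _ _).symm
    _ ≤ m * E₀ * (q ^ k₀ / (1 - q)) := by
        gcongr
        exact geom_sum_Ico_le_of_lt_one hq0.le hq1
    _ = _ := by rw [tailConst, ← hqk]; ring

end

/-! ### Lower bound for nonnegative averages by Hölder's inequality. -/

noncomputable section

variable {m : ℕ} {P : Fin m → ℝ[X]} {l : ℕ}
  {c B δ c₁ C₀ : ℝ} {n : ℕ} {F : 𝓢(ℝ, ℂ)} {f : ℝ → ℝ} {G H : ℕ → 𝓢(ℝ, ℂ)} {h : ℕ → ℝ → ℝ}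

/-- Hölder's inequality, used to bound a multilinear average from below. -/
lemma lintegral_pow_le_mul_prod {f : ℝ → ℝ≥0∞} {h : Fin m → ℝ → ℝ≥0∞} (hf : Measurable f)
    (hh : ∀ i, Measurable (h i)) (hhtop : ∀ i x, h i x ≠ ⊤)
    {q : ℝ≥0∞} (hq : q ≠ ⊤) (hle : ∀ i, ∫⁻ x, f x / h i x ≤ q) :
    (∫⁻ x, f x) ^ (m + 1) ≤ (∫⁻ x, f x * ∏ i, h i x) * q ^ m := by
  set p : ℝ := 1 / ((m : ℝ) + 1) with hp
  have hp0 : 0 ≤ p := by positivity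
  -- Where the `h i` do not vanish, `f` is the geometric mean of the `m + 1` functions `f ∏ h i` and
  -- `f / h i`. A zero of some `h i` with `f ≠ 0` makes the quotient infinite, which happens only on
  -- a null set.
  let u : Option (Fin m) → ℝ → ℝ≥0∞ := fun o => o.elim (fun x => f x * ∏ i, h i x)
    fun i x => f x / h i x
  have hu : ∀ o, Measurable (u o) := by
    intro o
    cases o with
    | none => exact hf.mul (Finset.measurable_fun_prod _ fun i _ => hh i)
    | some i => exact hf.div (hh i)
  have hol := ENNReal.lintegral_prod_norm_pow_le (μ := volume) (Finset.univ) (f := u)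
    (fun o _ => (hu o).aemeasurable) (p := fun _ => p)
    (by simp [hp]; field_simp) (fun _ _ => hp0)
  have hpos : ∀ᵐ x, ∀ i, f x / h i x < ⊤ := by
    rw [ae_all_iff]
    intro i
    exact ae_lt_top (hf.div (hh i)) ((hle i).trans_lt hq.lt_top).ne
  have e : ∫⁻ x, f x ≤ ∫⁻ x, ∏ o, u o x ^ p := by
    refine lintegral_mono_ae ?_
    filter_upwards [hpos] with x hx
    by_cases hfx : f x = 0
    · rw [hfx]; exact zero_le
    have hne : ∀ i, h i x ≠ 0 := by
      intro i hi
      have := hx i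
      rw [hi, ENNReal.div_zero hfx] at this
      exact lt_irrefl _ this
    rw [ENNReal.prod_rpow_of_nonneg hp0, Fintype.prod_option]
    have e1 : (u none x * ∏ i, u (some i) x) = f x ^ (m + 1) := by
      simp only [u, Option.elim]
      rw [mul_assoc, ← Finset.prod_mul_distrib]
      rw [Finset.prod_congr rfl fun i _ => ENNReal.mul_div_cancel (hne i) (hhtop i x)]
      simp [pow_succ, mul_comm]
    rw [e1, ← ENNReal.rpow_natCast, ← ENNReal.rpow_mul, hp]
    push_cast
    rw [mul_one_div_cancel (by positivity), ENNReal.rpow_one]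
  have h2 := e.trans hol
  rw [ENNReal.prod_rpow_of_nonneg hp0, Fintype.prod_option] at h2
  have h3 := pow_le_pow_left₀ zero_le h2 (m + 1)
  rw [← ENNReal.rpow_natCast (_ ^ p), ← ENNReal.rpow_mul, hp] at h3
  push_cast at h3
  rw [one_div_mul_cancel (by positivity), ENNReal.rpow_one] at h3
  refine h3.trans ?_
  gcongr
  · exact le_rfl
  · calc ∏ i : Fin m, ∫⁻ x, u (some i) x ≤ ∏ _i : Fin m, q :=
          Finset.prod_le_prod (fun _ _ => zero_le) fun i _ => hle i
      _ = q ^ m := by simp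

/-- The ratio of a density to its average at scale `2^{-k}` has bounded integral. -/
lemma ScaleFamily.lintegral_div_le (sf : ScaleFamily c B δ c₁ C₀ n F f G H h) {B₁ : ℝ}
    (hF : IsFrostman c B₁ n F f) (hδ : 0 < δ) (hc₁ : 0 < c₁) (k : ℕ) {s : ℝ}
    (hs : |s| ≤ δ / 2 / 2 ^ k) :
    ∫⁻ x, ENNReal.ofReal (f x) / ENNReal.ofReal (h k (x - s)) ≤
      ENNReal.ofReal ((6 / δ + 1) / c₁) := by
  -- Half the radius on which the averaging kernel is bounded below. On an interval of length `ρ` a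
  -- shift by at most `ρ` keeps the whole interval within that radius, so the average there
  -- dominates its mass and each of the roughly `3 / ρ` intervals contributes at most `1 / (c₁
  -- 2^k)`.
  set ρ := δ / 2 / 2 ^ k with hρ
  have hρ0 : 0 < ρ := by positivity
  have hfc : Continuous f := by
    have : f = fun x => (F x).re := by ext x; rw [hF.eq_coe, Complex.ofReal_re]
    rw [this]; exact Complex.continuous_re.comp F.continuous
  set J := ⌊3 / ρ⌋₊ + 1 with hJ
  let I : Fin J → Set ℝ := fun j => Set.Icc (-1 + j * ρ) (-1 + j * ρ + ρ)
  have hcover : Set.Icc (-1 : ℝ) 2 ⊆ ⋃ j, I j := by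
    intro x hx
    have h0 : 0 ≤ (x + 1) / ρ := div_nonneg (by linarith [hx.1]) hρ0.le
    have h1 : ⌊(x + 1) / ρ⌋₊ < J := by
      rw [hJ, Nat.lt_succ_iff]
      refine Nat.floor_mono ?_
      gcongr
      linarith [hx.2]
    refine Set.mem_iUnion.2 ⟨⟨_, h1⟩, ?_⟩
    have h2 := Nat.floor_le h0
    have h3 := Nat.lt_floor_add_one ((x + 1) / ρ)
    rw [le_div_iff₀ hρ0] at h2
    rw [div_lt_iff₀ hρ0] at h3
    simp only [I, Set.mem_Icc]
    constructor <;> linarith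
  have hpiece : ∀ z : ℝ, ∫⁻ x in Set.Icc z (z + ρ),
      ENNReal.ofReal (f x) / ENNReal.ofReal (h k (x - s)) ≤ ENNReal.ofReal (1 / (c₁ * 2 ^ k)) := by
    intro z
    set μI := ∫ y in Set.Icc z (z + ρ), f y with hμI
    have hμ0 : 0 ≤ μI := setIntegral_nonneg measurableSet_Icc fun x _ => hF.nonneg x
    have hlow : ∀ x ∈ Set.Icc z (z + ρ), c₁ * 2 ^ k * μI ≤ h k (x - s) := by
      intro x hx
      refine le_trans ?_ (sf.lower k (x - s))
      refine mul_le_mul_of_nonneg_left (setIntegral_mono_set hF.integrable.integrableOn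
        (Filter.Eventually.of_forall hF.nonneg) (LE.le.eventuallyLE ?_)) (by positivity)
      have h1 := abs_le.1 hs
      have h2 : δ / 2 ^ k = 2 * ρ := by rw [hρ]; ring
      rw [h2]
      exact Set.Icc_subset_Icc (by linarith [hx.2, h1.1]) (by linarith [hx.1, h1.2])
    calc ∫⁻ x in Set.Icc z (z + ρ), ENNReal.ofReal (f x) / ENNReal.ofReal (h k (x - s))
        ≤ ∫⁻ x in Set.Icc z (z + ρ), ENNReal.ofReal (f x) *
            (ENNReal.ofReal (c₁ * 2 ^ k * μI))⁻¹ := by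
          refine setLIntegral_mono' measurableSet_Icc fun x hx => ?_
          rw [div_eq_mul_inv]
          gcongr
          exact hlow x hx
      _ = (∫⁻ x in Set.Icc z (z + ρ), ENNReal.ofReal (f x)) *
            (ENNReal.ofReal (c₁ * 2 ^ k * μI))⁻¹ :=
          lintegral_mul_const _ hfc.measurable.ennreal_ofReal
      _ = ENNReal.ofReal μI * (ENNReal.ofReal (c₁ * 2 ^ k * μI))⁻¹ := by
          rw [← ofReal_integral_eq_lintegral_ofReal hF.integrable.integrableOn
            (Filter.Eventually.of_forall hF.nonneg)]
      _ ≤ _ := by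
          -- An interval of zero mass contributes `0 * ⊤ = 0`.
          rcases hμ0.eq_or_lt with h0 | h0
          · rw [← h0]; simp
          · rw [← div_eq_mul_inv, ← ENNReal.ofReal_div_of_pos (by positivity)]
            refine ENNReal.ofReal_le_ofReal (le_of_eq ?_)
            field_simp
  have hsupp : ∀ x, x ∉ Set.Icc (-1 : ℝ) 2 →
      ENNReal.ofReal (f x) / ENNReal.ofReal (h k (x - s)) = 0 := by
    intro x hx
    have : f x = 0 := by by_contra h0; exact hx (hF.support_subset x h0)
    simp [this]
  calc ∫⁻ x, ENNReal.ofReal (f x) / ENNReal.ofReal (h k (x - s))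
      = ∫⁻ x in Set.Icc (-1 : ℝ) 2, ENNReal.ofReal (f x) / ENNReal.ofReal (h k (x - s)) :=
        (setLIntegral_eq_of_support_subset fun x hx => by
          by_contra h0; exact hx (hsupp x h0)).symm
    _ ≤ ∫⁻ x in ⋃ j, I j, ENNReal.ofReal (f x) / ENNReal.ofReal (h k (x - s)) :=
        lintegral_mono_set hcover
    _ ≤ ∑' j, ∫⁻ x in I j, ENNReal.ofReal (f x) / ENNReal.ofReal (h k (x - s)) :=
        lintegral_iUnion_le _ _
    _ ≤ ∑ _j : Fin J, ENNReal.ofReal (1 / (c₁ * 2 ^ k)) := by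
        rw [tsum_fintype]
        exact Finset.sum_le_sum fun j _ => hpiece _
    _ = ENNReal.ofReal (J * (1 / (c₁ * 2 ^ k))) := by
        rw [Finset.sum_const, Finset.card_univ, Fintype.card_fin, nsmul_eq_mul,
          ENNReal.ofReal_mul (by positivity), ENNReal.ofReal_natCast]
    _ ≤ _ := by
        refine ENNReal.ofReal_le_ofReal ?_
        have h1 : (J : ℝ) ≤ 3 / ρ + 1 := by
          rw [hJ]; push_cast
          linarith [Nat.floor_le (by positivity : 0 ≤ 3 / ρ)]
        have h2 : (1 : ℝ) ≤ 2 ^ k := one_le_pow₀ one_le_two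
        calc (J : ℝ) * (1 / (c₁ * 2 ^ k)) ≤ (3 / ρ + 2 ^ k) * (1 / (c₁ * 2 ^ k)) := by
              gcongr; linarith
          _ = _ := by rw [hρ]; field_simp; ring

lemma ScaleFamily.le_integral_slice (sf : ScaleFamily c B δ c₁ C₀ n F f G H h) {B₁ : ℝ}
    (hF : IsFrostman c B₁ n F f) (hδ : 0 < δ) (hc₁ : 0 < c₁) (k : Fin m → ℕ) {s : Fin m → ℝ}
    (hs : ∀ i, |s i| ≤ δ / 2 / 2 ^ k i)
    (hint : Integrable fun x => f x * ∏ i, h (k i) (x - s i)) :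
    (∫ x, f x) ^ (m + 1) ≤
      (∫ x, f x * ∏ i, h (k i) (x - s i)) * ((6 / δ + 1) / c₁) ^ m := by
  have hfc : Continuous f := by
    have : f = fun x => (F x).re := by ext x; rw [hF.eq_coe, Complex.ofReal_re]
    rw [this]; exact Complex.continuous_re.comp F.continuous
  have hhc : ∀ k, Continuous (h k) := by
    intro k
    have : h k = fun x => (H k x).re := by ext x; rw [sf.coe_eq, Complex.ofReal_re]
    rw [this]; exact Complex.continuous_re.comp (H k).continuous
  have key := lintegral_pow_le_mul_prod (f := fun x => ENNReal.ofReal (f x))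
    (h := fun i x => ENNReal.ofReal (h (k i) (x - s i))) hfc.measurable.ennreal_ofReal
    (fun i => ((hhc (k i)).comp (by fun_prop)).measurable.ennreal_ofReal)
    (fun _ _ => ENNReal.ofReal_ne_top) ENNReal.ofReal_ne_top
    (fun i => sf.lintegral_div_le hF hδ hc₁ (k i) (hs i))
  have e : ∀ x, ENNReal.ofReal (f x) * ∏ i, ENNReal.ofReal (h (k i) (x - s i)) =
      ENNReal.ofReal (f x * ∏ i, h (k i) (x - s i)) := fun x => by
    rw [ENNReal.ofReal_mul (hF.nonneg x), ENNReal.ofReal_prod_of_nonneg fun i _ => sf.nonneg _ _]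
  simp only [e] at key
  have hnn : ∀ x, 0 ≤ f x * ∏ i, h (k i) (x - s i) := fun x =>
    mul_nonneg (hF.nonneg x) (Finset.prod_nonneg fun i _ => sf.nonneg _ _)
  have hI : 0 ≤ ∫ x, f x * ∏ i, h (k i) (x - s i) := integral_nonneg hnn
  rw [← ofReal_integral_eq_lintegral_ofReal hF.integrable (Filter.Eventually.of_forall hF.nonneg),
    ← ofReal_integral_eq_lintegral_ofReal hint (Filter.Eventually.of_forall hnn),
    ← ENNReal.ofReal_pow (integral_nonneg hF.nonneg), ← ENNReal.ofReal_pow (by positivity),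
    ← ENNReal.ofReal_mul hI] at key
  exact (ENNReal.ofReal_le_ofReal_iff (by positivity)).1 key

/-- Lower bound for the form on nonnegative averages at scales dominating the shifts. -/
lemma ScaleFamily.le_re_progForm (sf : ScaleFamily c B δ c₁ C₀ n F f G H h) {B₁ : ℝ}
    (hF : IsFrostman c B₁ n F f) (hδ : 0 < δ) (hc₁ : 0 < c₁) (k : Fin m → ℕ)
    (hs : ∀ i, ∀ t ∈ Set.Ioc (0 : ℝ) 1, |(P i).eval (t / 2 ^ l)| ≤ δ / 2 / 2 ^ k i) :
    (∫ x, f x) ^ (m + 1) / ((6 / δ + 1) / c₁) ^ m ≤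
      (progForm P l F (fun i => H (k i))).re := by
  set M := (∫ x, f x) ^ (m + 1) / ((6 / δ + 1) / c₁) ^ m
  have hreal : ∀ z, progIntegrand P l F (fun i => H (k i)) z =
      ((f z.1 * ∏ i, h (k i) (z.1 - (P i).eval (z.2 / 2 ^ l)) : ℝ) : ℂ) := by
    intro z
    simp [progIntegrand, hF.eq_coe, sf.coe_eq]
  have hslice : ∀ t ∈ Set.Ioc (0 : ℝ) 1,
      M ≤ (∫ x, progIntegrand P l F (fun i => H (k i)) (x, t)).re := by
    intro t ht
    simp only [hreal]
    rw [integral_complex_ofReal, Complex.ofReal_re, div_le_iff₀ (by positivity)]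
    refine sf.le_integral_slice hF hδ hc₁ k (fun i => hs i t ht) ?_
    have := (integrable_progIntegrand_slice (P := P) (l := l) (g₀ := F)
      (g := fun i => H (k i)) t).re
    simp only [hreal] at this
    exact this
  rw [progForm_eq_iterated]
  have hint : Integrable (fun t => ∫ x, progIntegrand P l F (fun i => H (k i)) (x, t))
      (volume.restrict (Set.Ioc (0 : ℝ) 1)) :=
    Integrable.integral_prod_right (f := progIntegrand P l F (fun i => H (k i)))
      integrable_progIntegrand
  have e := integral_re (𝕜 := ℂ) hint
  simp only [RCLike.re_to_complex] at e
  rw [← e]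
  calc M = ∫ _t in Set.Ioc (0 : ℝ) 1, M := by simp
    _ ≤ _ := setIntegral_mono_on (by simp) hint.re measurableSet_Ioc hslice

end

/-! ### Energy pigeonholing and the choice of a good scale. -/

noncomputable section

variable {m : ℕ} {P : Fin m → ℝ[X]} {l : ℕ}
  {c B δ c₁ C₀ : ℝ} {n : ℕ} {F : 𝓢(ℝ, ℂ)} {f : ℝ → ℝ} {G H : ℕ → 𝓢(ℝ, ℂ)} {h : ℕ → ℝ → ℝ}

/-- Telescoping: by `huv` each new positive term is cancelled by the preceding negative one. It
expresses the bounded overlap of the frequency bands. -/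
lemma sum_sub_le_one {u v : ℕ → ℝ} (hu : u 0 ≤ 1) (hv : ∀ j, 0 ≤ v j)
    (huv : ∀ j, u (j + 1) ≤ v j) (J : ℕ) : ∑ j ∈ Finset.range J, (u j - v j) ≤ 1 := by
  have key : ∀ J, ∑ j ∈ Finset.range (J + 1), (u j - v j) ≤ 1 - v J := by
    intro J
    induction J with
    | zero => simpa using hu
    | succ J ih =>
      rw [Finset.sum_range_succ]
      linarith [huv J]
  cases J with
  | zero => simp
  | succ J => linarith [key J, hv J]

lemma ScaleFamily.fourier_eq (sf : ScaleFamily c B δ c₁ C₀ n F f G H h) (k : ℕ) {ξ : ℝ}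
    (hξ : |ξ| ≤ 2 ^ k) : 𝓕 (G k) ξ = 𝓕 F ξ := by
  have h1 := sf.high k (k + (n + 1)) (by omega) ξ hξ
  rw [sf.eq_of_lt (k + (n + 1)) (by omega)] at h1
  have h2 : 𝓕 (F - G k) = 𝓕 F - 𝓕 (G k) := by
    simpa using (FourierTransform.fourierCLM ℂ 𝓢(ℝ, ℂ)).map_sub F (G k)
  rw [h2, sub_apply, sub_eq_zero] at h1
  exact h1.symm

/-- Energy estimate: over separated scales, the differences between the two approximations are
square summable. -/
lemma ScaleFamily.sum_energy_le (sf : ScaleFamily c B δ c₁ C₀ n F f G H h) (hC₀ : 0 < C₀)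
    {K ν L J e n₀ : ℕ} (hν : 1 ≤ ν) (hL : ν + K + 3 ≤ L) (he : 1 ≤ e) (hn₀ : J * L * e + ν + 1 ≤ n₀)
    (hn : n₀ ≤ n) :
    ∑ j ∈ Finset.range J,
      ∫ x, ‖(G ((j + 1) * L * e + ν) - H ((j + 1) * L * e - K)) x‖ ^ 2 ≤
      C₀ * ∫ x, ‖G n₀ x‖ ^ 2 := by
  set k : ℕ → ℕ := fun j => (j + 1) * L * e + ν with hk
  set k' : ℕ → ℕ := fun j => (j + 1) * L * e - K with hk'
  have hLe : L ≤ L * e := Nat.le_mul_of_pos_right _ he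
  have hjL : ∀ j, (j + 1) * L * e = j * L * e + L * e := fun j => by ring
  have hkk : ∀ j, k' j < k j := by
    intro j
    simp only [hk, hk']
    have := hjL j
    omega
  -- The gap `L ≥ ν + K + 3` separates consecutive bands; the `3` matches the factors `2` and `1/4`
  -- inside the two truncations of the multiplier bound.
  have hsep : ∀ j, k j + 3 ≤ k' (j + 1) := by
    intro j
    simp only [hk, hk']
    have := hjL j
    have := hjL (j + 1)
    omega
  have hkn : ∀ j ∈ Finset.range J, k j + 1 ≤ n₀ := by
    intro j hj
    have h1 : j + 1 ≤ J := Finset.mem_range.1 hj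
    have h2 : (j + 1) * L * e ≤ J * L * e := by gcongr
    simp only [hk]
    omega
  set u : ℝ → ℕ → ℝ := fun ξ j => min (2 * |ξ| / 2 ^ k' j) 1 with hu
  set v : ℝ → ℕ → ℝ := fun ξ j => min (|ξ| / 2 ^ (k j + 2)) 1 with hv
  have huv : ∀ ξ j, u ξ (j + 1) ≤ v ξ j := by
    intro ξ j
    refine min_le_min_right _ ?_
    calc 2 * |ξ| / 2 ^ k' (j + 1) ≤ 2 * |ξ| / 2 ^ (k j + 3) := by
          gcongr
          · norm_num
          · exact hsep j
      _ = |ξ| / 2 ^ (k j + 2) := by rw [pow_succ 2 (k j + 2)]; field_simp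
  have hvu : ∀ ξ j, v ξ j ≤ u ξ j := by
    intro ξ j
    refine min_le_min_right _ ?_
    have h1 : (2 : ℝ) ^ k' j ≤ 2 ^ (k j + 2) :=
      pow_le_pow_right₀ one_le_two (by have := hkk j; omega)
    gcongr
    linarith [abs_nonneg ξ]
  have hpt : ∀ j ∈ Finset.range J, ∀ ξ : ℝ, ‖𝓕 (G (k j) - H (k' j)) ξ‖ ^ 2 ≤
      C₀ * (u ξ j - v ξ j) * ‖𝓕 (G n₀) ξ‖ ^ 2 := by
    intro j hj ξ
    have hkj := hkn j hj
    have hkkj := hkk j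
    have e1 : 𝓕 (G (k j) - H (k' j)) ξ = 𝓕 (G (k j)) ξ - 𝓕 (H (k' j)) ξ := by
      have : 𝓕 (G (k j) - H (k' j)) = 𝓕 (G (k j)) - 𝓕 (H (k' j)) := by
        simpa using (FourierTransform.fourierCLM ℂ 𝓢(ℝ, ℂ)).map_sub (G (k j)) (H (k' j))
      rw [this, sub_apply]
    rw [e1]
    -- The bound is against `G n₀`, whose `L²` norm is under control, and not `F`: below `2^{n₀}`
    -- their transforms agree, and above it the left side vanishes.
    by_cases hξ : |ξ| ≤ 2 ^ n₀
    · rw [sf.fourier_eq n₀ hξ]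
      exact sf.energy (k j) (by omega) (k' j) (by omega) ξ
    · push Not at hξ
      have h1 : (2 : ℝ) ^ (k j + 1) ≤ 2 ^ n₀ := pow_le_pow_right₀ one_le_two hkj
      have h2 : (2 : ℝ) ^ (k' j + 2) ≤ 2 ^ n₀ := pow_le_pow_right₀ one_le_two (by omega)
      rw [sf.low (k j) (by omega) ξ (by linarith), sf.low' (k' j) ξ (by linarith)]
      have : 0 ≤ C₀ * (u ξ j - v ξ j) * ‖𝓕 (G n₀) ξ‖ ^ 2 :=
        mul_nonneg (mul_nonneg hC₀.le (by linarith [hvu ξ j])) (by positivity)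
      simpa using this
  calc ∑ j ∈ Finset.range J, ∫ x, ‖(G (k j) - H (k' j)) x‖ ^ 2
      = ∑ j ∈ Finset.range J, ∫ ξ, ‖𝓕 (G (k j) - H (k' j)) ξ‖ ^ 2 :=
        Finset.sum_congr rfl fun j _ => (SchwartzMap.integral_norm_sq_fourier _).symm
    _ = ∫ ξ, ∑ j ∈ Finset.range J, ‖𝓕 (G (k j) - H (k' j)) ξ‖ ^ 2 :=
        (integral_finsetSum _ fun j _ => integrable_norm_sq _).symm
    _ ≤ ∫ ξ, C₀ * ‖𝓕 (G n₀) ξ‖ ^ 2 := by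
        refine integral_mono (integrable_finsetSum _ fun j _ => integrable_norm_sq _)
          ((integrable_norm_sq _).const_mul _) fun ξ => ?_
        calc ∑ j ∈ Finset.range J, ‖𝓕 (G (k j) - H (k' j)) ξ‖ ^ 2
            ≤ ∑ j ∈ Finset.range J, C₀ * (u ξ j - v ξ j) * ‖𝓕 (G n₀) ξ‖ ^ 2 :=
              Finset.sum_le_sum fun j hj => hpt j hj ξ
          _ = C₀ * (∑ j ∈ Finset.range J, (u ξ j - v ξ j)) * ‖𝓕 (G n₀) ξ‖ ^ 2 := by
              rw [Finset.mul_sum, Finset.sum_mul]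
          _ ≤ C₀ * 1 * ‖𝓕 (G n₀) ξ‖ ^ 2 := by
              gcongr
              exact sum_sub_le_one (min_le_right _ _) (fun j => by positivity) (huv ξ) J
          _ = _ := by rw [mul_one]
    _ = C₀ * ∫ x, ‖G n₀ x‖ ^ 2 := by
        rw [integral_const_mul, SchwartzMap.integral_norm_sq_fourier]

lemma integral_norm_sq_le {g : 𝓢(ℝ, ℂ)} {b b' : ℝ} (hb : ∀ x, ‖g x‖ ≤ b)
    (hb' : ∫ x, ‖g x‖ ≤ b') : ∫ x, ‖g x‖ ^ 2 ≤ b * b' := by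
  have hb0 : 0 ≤ b := (norm_nonneg _).trans (hb 0)
  calc ∫ x, ‖g x‖ ^ 2 ≤ ∫ x, b * ‖g x‖ := by
        refine integral_mono (integrable_norm_sq g) (g.integrable.norm.const_mul b) fun x => ?_
        simp only [sq]
        gcongr
        exact hb x
    _ = b * ∫ x, ‖g x‖ := integral_const_mul _ _
    _ ≤ _ := by gcongr

/-- Some scale `l` among `L, 2L, …, JL` carries many progressions. -/
lemma ScaleFamily.exists_scale_lower_bound (hm : 1 ≤ m) {σ C : ℝ} (hE : SobolevEstimate P σ C)
    (sf : ScaleFamily c B δ c₁ C₀ n F f G H h) {B₁ : ℝ} (hF : IsFrostman c B₁ n F f)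
    (hB : 1 ≤ B) (hδ : 0 < δ) (hc₁ : 0 < c₁) (hC₀ : 0 < C₀) (hc : 0 ≤ c) (hc1 : c ≤ 1)
    (hcσ : c * (m + 1) ≤ σ / 4) {r : ℕ} (hr : 2 * m ≤ 2 ^ r) {K ν L J E n₀ : ℕ}
    (hν : 1 ≤ ν) (hL : ν + K + 3 ≤ L) (hCL : C ≤ L) (hJ : 1 ≤ J)
    (hE1 : ∀ i, 1 ≤ vanishingOrder (P i)) (hEE : ∀ i, vanishingOrder (P i) ≤ E)
    (hP : ∀ i, ∀ u ∈ Set.Icc (0 : ℝ) 1, |(P i).eval u| ≤ δ / 2 * 2 ^ K * u ^ vanishingOrder (P i))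
    (hn₀ : 2 * (J * L * E) + ν + 1 ≤ n₀) (hn : n₀ + r ≤ n) (hcn : (n₀ + r : ℝ) * c ≤ 1)
    {η : ℝ} (hη : 0 < η) :
    ∃ l, L ≤ l ∧ l ≤ J * L ∧
      (∫ x, f x) ^ (m + 1) / ((6 / δ + 1) / c₁) ^ m
        - tailConst m r σ C B * (2 : ℝ) ^ (-(n₀ : ℝ) * (σ / 4))
        - m * (2 * B * (C * (2 : ℝ) ^ (-(ν : ℝ) * σ)) * (4 * B) ^ m)
        - m * ((2 * B) ^ (m - 1) * (η * (2 * B ^ 2) + η⁻¹ * (m * (C₀ * (2 * B ^ 2)) / J)))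
      ≤ (progForm P l F (fun _ => F)).re := by
  have hσ := hE.1
  have hC : 0 < C := hE.1.trans hE.2.1
  -- This is where `c` must be small compared with the number of scales: up to `n₀ + r` all Frostman
  -- losses are at most `2`.
  have hpow : ∀ k ≤ n₀ + r, (2 : ℝ) ^ ((k : ℝ) * c) ≤ 2 := by
    intro k hk
    have h1 : (k : ℝ) ≤ n₀ + r := by exact_mod_cast hk
    calc (2 : ℝ) ^ ((k : ℝ) * c) ≤ (2 : ℝ) ^ (1 : ℝ) := by
          refine Real.rpow_le_rpow_of_exponent_le one_le_two ?_
          nlinarith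
      _ = 2 := Real.rpow_one 2
  have hGb : ∀ k ≤ n₀ + r, ∀ x, ‖G k x‖ ≤ 2 * B := by
    intro k hk x
    have := sf.norm_le k x
    have := hpow k hk
    nlinarith
  have hHb : ∀ k ≤ n₀, ∀ x, ‖H k x‖ ≤ 2 * B := by
    intro k hk x
    have := sf.norm_le' k (by omega) x
    have := hpow k (by omega)
    nlinarith
  have hG2 : ∀ k ≤ n₀ + r, ∫ x, ‖G k x‖ ^ 2 ≤ 2 * B ^ 2 := by
    intro k hk
    refine (integral_norm_sq_le (hGb k hk) (sf.integral_norm_le k)).trans (le_of_eq (by ring))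
  -- pigeonhole over the scales
  set D : ℕ → Fin m → ℝ := fun j i => ∫ x, ‖(G ((j + 1) * L * vanishingOrder (P i) + ν) -
    H ((j + 1) * L * vanishingOrder (P i) - K)) x‖ ^ 2 with hD
  have hD0 : ∀ j i, 0 ≤ D j i := fun j i => integral_nonneg fun x => by positivity
  have hsum : ∑ j ∈ Finset.range J, ∑ i, D j i ≤
      ∑ _j ∈ Finset.range J, m * (C₀ * (2 * B ^ 2)) / (J : ℝ) := by
    rw [Finset.sum_comm, Finset.sum_const, Finset.card_range, nsmul_eq_mul,
      mul_div_cancel₀ _ (by positivity)]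
    calc ∑ i, ∑ j ∈ Finset.range J, D j i ≤ ∑ _i : Fin m, C₀ * (2 * B ^ 2) := by
          refine Finset.sum_le_sum fun i _ => ?_
          refine (sf.sum_energy_le hC₀ (n₀ := n₀) hν hL (hE1 i) ?_ (by omega)).trans ?_
          · have : J * L * vanishingOrder (P i) ≤ J * L * E := by gcongr; exact hEE i
            omega
          · gcongr
            exact hG2 n₀ (by omega)
      _ = _ := by simp
  obtain ⟨j, hj, hDj⟩ := Finset.exists_le_of_sum_le (by simpa using by omega) hsum
  rw [Finset.mem_range] at hj
  have hDi : ∀ i, D j i ≤ m * (C₀ * (2 * B ^ 2)) / (J : ℝ) := fun i =>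
    (Finset.single_le_sum (fun i _ => hD0 j i) (Finset.mem_univ i)).trans hDj
  set l := (j + 1) * L with hl
  have hLl : L ≤ l := Nat.le_mul_of_pos_left _ (by omega)
  have hlJ : l ≤ J * L := by rw [hl]; gcongr; omega
  have hCl : C ≤ l := hCL.trans (by exact_mod_cast hLl)
  have hlE : ∀ i, l * vanishingOrder (P i) ≤ J * L * E := fun i => Nat.mul_le_mul hlJ (hEE i)
  have hlK : ∀ i, K ≤ l * vanishingOrder (P i) := fun i => by
    have := Nat.le_mul_of_pos_right l (hE1 i)
    omega
  refine ⟨l, hLl, hlJ, ?_⟩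
  set k : Fin m → ℕ := fun i => l * vanishingOrder (P i) + ν with hk
  set k' : Fin m → ℕ := fun i => l * vanishingOrder (P i) - K with hk'
  have hkn : ∀ i, k i ≤ n₀ := fun i => by have := hlE i; simp only [hk]; omega
  have hkn' : ∀ i, k' i + 1 ≤ n₀ := fun i => by have := hlE i; simp only [hk']; omega
  -- Chain of replacements: `t1` truncates at `2^{n₀}` and `t2` truncates the `i`-th factor at `2^{l
  -- e_i + ν}`, both by the Sobolev estimate; `t3` passes to the averages at scale `2^{-(l e_i -
  -- K)}` by the energy bound.
  have t1 := sf.tail_le hm hE hCl hB hc hc1 hcσ hr (k₀ := n₀)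
    (fun i => by have := hlE i; omega) (by omega)
  have t2 : ‖progForm P l (G (n₀ + r)) (fun _ => G n₀) -
      progForm P l (G (n₀ + r)) (fun i => G (k i))‖ ≤
      m * (2 * B * (C * (2 : ℝ) ^ (-(ν : ℝ) * σ)) * (4 * B) ^ m) := by
    have := norm_progForm_sub_le (P := P) (l := l) (g₀ := G (n₀ + r)) (u := fun _ => G n₀)
      (v := fun i => G (k i))
      (δ := fun _ => 2 * B * (C * (2 : ℝ) ^ (-(ν : ℝ) * σ)) * (4 * B) ^ m) ?_
    · simpa using this
    intro i g hgi hg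
    refine (sf.norm_progForm_le hm hE hCl hB hc (K := n₀) (k₀ := n₀ + r) (ν := ν) i
      (hkn i) le_rfl le_rfl hgi ?_).trans ?_
    · intro q hq
      rcases hg q hq with h1 | h1
      · exact ⟨n₀, le_rfl, h1⟩
      · exact ⟨k q, hkn q, h1⟩
    · have h1 := hpow (n₀ + r) le_rfl
      have h2 := hpow n₀ (by omega)
      have h3 : B * (2 : ℝ) ^ (((n₀ + r : ℕ) : ℝ) * c) ≤ 2 * B := by nlinarith
      have h4 : 2 * B * (2 : ℝ) ^ ((n₀ : ℝ) * c) ≤ 4 * B := by nlinarith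
      gcongr
  have t3 : ‖progForm P l (G (n₀ + r)) (fun i => G (k i)) -
      progForm P l (G (n₀ + r)) (fun i => H (k' i))‖ ≤
      m * ((2 * B) ^ (m - 1) * (η * (2 * B ^ 2) + η⁻¹ * (m * (C₀ * (2 * B ^ 2)) / J))) := by
    have := norm_progForm_sub_le (P := P) (l := l) (g₀ := G (n₀ + r)) (u := fun i => G (k i))
      (v := fun i => H (k' i)) (δ := fun _ =>
        (2 * B) ^ (m - 1) * (η * (2 * B ^ 2) + η⁻¹ * (m * (C₀ * (2 * B ^ 2)) / J))) ?_
    · simpa using this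
    intro i g hgi hg
    refine (norm_progForm_le_sq i hη (b := 2 * B) (by positivity) ?_).trans ?_
    · intro q hq x
      rcases hg q hq with h1 | h1
      · rw [h1]; exact hGb (k q) ((hkn q).trans (by omega)) x
      · rw [h1]; exact hHb (k' q) (by have := hkn' q; omega) x
    · rw [hgi]
      gcongr
      · exact hG2 _ le_rfl
      · exact hDi i
  -- By frequency support the first entry can be changed back to `F`, so that the Hölder lower bound
  -- applies with the nonnegative weight `f`.
  have t4 : progForm P l F (fun i => H (k' i)) =
      progForm P l (G (n₀ + r)) (fun i => H (k' i)) := by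
    rw [← sub_eq_zero, ← progForm_sub_left]
    refine progForm_eq_zero_of_freq hm (R := 2 ^ (n₀ + 1)) ?_ fun i => (sf.low' (k' i)).mono
      (pow_le_pow_right₀ one_le_two (by have := hkn' i; omega))
    have h1 := sf.high (n₀ + r) (n + 1) (by omega)
    rw [sf.eq_of_lt (n + 1) (by omega)] at h1
    refine h1.mono ?_
    have : (2 * m : ℝ) ≤ 2 ^ r := by exact_mod_cast hr
    calc (m : ℝ) * 2 ^ (n₀ + 1) = 2 ^ n₀ * (2 * m) := by ring
      _ ≤ 2 ^ n₀ * 2 ^ r := by gcongr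
      _ = 2 ^ (n₀ + r) := (pow_add _ _ _).symm
  have t5 := sf.le_re_progForm (P := P) (l := l) hF hδ hc₁ k' (by
    intro i t ht
    have hl1 : (1 : ℝ) ≤ 2 ^ l := one_le_pow₀ one_le_two
    have hu : t / 2 ^ l ∈ Set.Icc (0 : ℝ) 1 :=
      ⟨div_nonneg ht.1.le (by positivity), div_le_one_of_le₀ (by linarith [ht.2]) (by positivity)⟩
    refine (hP i _ hu).trans ?_
    have h1 : (t / 2 ^ l) ^ vanishingOrder (P i) ≤ (1 / 2 ^ l) ^ vanishingOrder (P i) := by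
      have := ht.1
      gcongr
      exact ht.2
    calc δ / 2 * 2 ^ K * (t / 2 ^ l) ^ vanishingOrder (P i)
        ≤ δ / 2 * 2 ^ K * (1 / 2 ^ l) ^ vanishingOrder (P i) := by gcongr
      _ = δ / 2 / 2 ^ k' i := by
          rw [one_div, inv_pow, ← pow_mul, mul_assoc, div_eq_mul_inv (δ / 2)]
          congr 1
          rw [hk']
          simp only
          have e : (2 : ℝ) ^ (l * vanishingOrder (P i)) =
              2 ^ (l * vanishingOrder (P i) - K) * 2 ^ K := by
            rw [← pow_add, Nat.sub_add_cancel (hlK i)]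
          rw [e]
          field_simp)
  rw [t4] at t5
  have r1 := (abs_le.1 ((Complex.abs_re_le_norm _).trans t1)).1
  have r2 := (abs_le.1 ((Complex.abs_re_le_norm _).trans t2)).1
  have r3 := (abs_le.1 ((Complex.abs_re_le_norm _).trans t3)).1
  simp only [Complex.sub_re] at r1 r2 r3
  linarith

end

/-! ### Polynomial bounds, rescaling in `t`, parameters and compactness. -/

noncomputable section

variable {m : ℕ} {P : Fin m → ℝ[X]} {l : ℕ}
  {c B δ c₁ C₀ : ℝ} {n : ℕ} {F : 𝓢(ℝ, ℂ)} {f : ℝ → ℝ} {G H : ℕ → 𝓢(ℝ, ℂ)} {h : ℕ → ℝ → ℝ}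

lemma RelativelyCurved.one_le_vanishingOrder (hP : RelativelyCurved P) (i : Fin m) :
    1 ≤ vanishingOrder (P i) := by
  rw [Nat.one_le_iff_ne_zero, vanishingOrder, Ne, Polynomial.natTrailingDegree_eq_zero]
  rintro (h0 | h0)
  · exact hP.ne_zero i h0
  · exact h0 (by rw [Polynomial.coeff_zero_eq_eval_zero]; exact hP.eval_zero i)

lemma abs_eval_le_vanishingOrder (p : ℝ[X]) {u : ℝ} (hu : u ∈ Set.Icc (0 : ℝ) 1) :
    |p.eval u| ≤ (∑ j ∈ p.support, |p.coeff j|) * u ^ vanishingOrder p := by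
  rw [Polynomial.eval_eq_sum, Polynomial.sum, Finset.sum_mul]
  refine (Finset.abs_sum_le_sum_abs _ _).trans (Finset.sum_le_sum fun j hj => ?_)
  rw [abs_mul, abs_pow, abs_of_nonneg hu.1]
  exact mul_le_mul_of_nonneg_left
    (pow_le_pow_of_le_one hu.1 hu.2 (Polynomial.natTrailingDegree_le_of_mem_supp j hj))
    (abs_nonneg _)

/-- The factor `2^K` absorbs the coefficients, so the averages at scale `2^{-(l e_i - K)}` are wide
enough to dominate the shifts. -/
lemma exists_abs_eval_le (P : Fin m → ℝ[X]) {δ : ℝ} (hδ : 0 < δ) : ∃ K : ℕ, ∀ i,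
    ∀ u ∈ Set.Icc (0 : ℝ) 1, |(P i).eval u| ≤ δ * 2 ^ K * u ^ vanishingOrder (P i) := by
  set S := ∑ i, ∑ j ∈ (P i).support, |(P i).coeff j|
  obtain ⟨K, hK⟩ := pow_unbounded_of_one_lt (S / δ) one_lt_two
  refine ⟨K, fun i u hu => (abs_eval_le_vanishingOrder (P i) hu).trans ?_⟩
  rw [div_lt_iff₀ hδ] at hK
  have h1 : ∑ j ∈ (P i).support, |(P i).coeff j| ≤ S :=
    Finset.single_le_sum (f := fun i => ∑ j ∈ (P i).support, |(P i).coeff j|)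
      (fun i _ => Finset.sum_nonneg fun j _ => abs_nonneg _) (Finset.mem_univ i)
  have := hu.1
  gcongr
  linarith

/-- If the form has no mass for `t > 2^{-q}`, then it rescales to the form at scale
`2^{-(l + q)}`. -/
lemma progForm_eq_smul_of_vanish {g₀ : 𝓢(ℝ, ℂ)} {g : Fin m → 𝓢(ℝ, ℂ)} (q : ℕ)
    (h0 : ∀ x, ∀ t ∈ Set.Ioc (((2 : ℝ) ^ q)⁻¹) 1, progIntegrand P l g₀ g (x, t) = 0) :
    progForm P l g₀ g = ((2 : ℂ) ^ q)⁻¹ * progForm P (l + q) g₀ g := by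
  set I : ℝ → ℂ := fun t => ∫ x, progIntegrand P l g₀ g (x, t) with hI
  have hint : IntegrableOn I (Set.Ioc 0 1) :=
    Integrable.integral_prod_right (f := progIntegrand P l g₀ g) integrable_progIntegrand
  have hq0 : (0 : ℝ) < (2 ^ q)⁻¹ := by positivity
  have hq1 : ((2 : ℝ) ^ q)⁻¹ ≤ 1 := inv_le_one_of_one_le₀ (one_le_pow₀ one_le_two)
  have e1 : progForm P l g₀ g = ∫ t in Set.Ioc (0 : ℝ) ((2 ^ q)⁻¹), I t := by
    rw [progForm_eq_iterated, ← Set.Ioc_union_Ioc_eq_Ioc hq0.le hq1,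
      setIntegral_union (Set.Ioc_disjoint_Ioc_of_le le_rfl) measurableSet_Ioc
        (hint.mono_set (Set.Ioc_subset_Ioc_right hq1))
        (hint.mono_set (Set.Ioc_subset_Ioc_left hq0.le))]
    have : ∫ t in Set.Ioc (((2 : ℝ) ^ q)⁻¹) 1, I t = 0 :=
      setIntegral_eq_zero_of_forall_eq_zero fun t ht => by
        simp only [hI]
        exact integral_eq_zero_of_ae (Filter.Eventually.of_forall fun x => h0 x t ht)
    rw [this, add_zero]
  have e2 : ∀ t, ∫ x, progIntegrand P (l + q) g₀ g (x, t) = I (t / 2 ^ q) := by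
    intro t
    simp only [hI, progIntegrand, div_div, pow_add, mul_comm ((2 : ℝ) ^ q)]
  rw [e1, progForm_eq_iterated]
  simp only [e2]
  rw [← intervalIntegral.integral_of_le zero_le_one, ← intervalIntegral.integral_of_le hq0.le,
    intervalIntegral.integral_comp_div I (by positivity : (2 : ℝ) ^ q ≠ 0), zero_div, one_div,
    Complex.real_smul]
  push_cast
  rw [← mul_assoc, inv_mul_cancel₀ (pow_ne_zero _ two_ne_zero), one_mul]

/-- An upper bound growing more slowly than `2^l`, which loses to the factor `2^{-q}` from rescaling
`t`. Above frequency `2^{2lE}` the tail is bounded; below it sup norms cost `2^{2lEcm} ≤ 2^{l/2}`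
because `4cEm ≤ 1`. -/
lemma ScaleFamily.norm_progForm_le_rpow (hm : 1 ≤ m) {σ C : ℝ} (hE : SobolevEstimate P σ C)
    (hl : C ≤ l) (sf : ScaleFamily c B δ c₁ C₀ n F f G H h) (hB : 1 ≤ B) (hc : 0 ≤ c)
    (hc1 : c ≤ 1) (hcσ : c * (m + 1) ≤ σ / 4) {r : ℕ} (hr : 2 * m ≤ 2 ^ r) {E : ℕ}
    (hEE : ∀ i, vanishingOrder (P i) ≤ E) (hcE : 4 * (c * E * m) ≤ 1) (hn : 2 * (l * E) ≤ n) :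
    ‖progForm P l F (fun _ => F)‖ ≤
      (tailConst m r σ C B + B ^ (m + 1)) * (2 : ℝ) ^ ((l : ℝ) / 2) := by
  have hσ := hE.1
  have hC : 0 < C := hE.1.trans hE.2.1
  have htc : 0 ≤ tailConst m r σ C B := tailConst_nonneg hσ hC hB
  have t1 := sf.tail_le hm hE hl hB hc hc1 hcσ hr (k₀ := 2 * (l * E))
    (fun i => by have := hEE i; gcongr) hn
  have h1 : (2 : ℝ) ^ (-((2 * (l * E) : ℕ) : ℝ) * (σ / 4)) ≤ 1 :=
    Real.rpow_le_one_of_one_le_of_nonpos one_le_two (by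
      have : (0 : ℝ) ≤ ((2 * (l * E) : ℕ) : ℝ) := Nat.cast_nonneg _
      nlinarith)
  have h2 : 1 ≤ (2 : ℝ) ^ ((l : ℝ) / 2) := Real.one_le_rpow one_le_two (by positivity)
  have t2 := norm_progForm_le_trivial (P := P) (l := l) (g₀ := G (2 * (l * E) + r))
    (g := fun _ => G (2 * (l * E))) (fun _ x => sf.norm_le (2 * (l * E)) x)
  have h3 : (B * (2 : ℝ) ^ (((2 * (l * E) : ℕ) : ℝ) * c)) ^ m ≤
      B ^ m * (2 : ℝ) ^ ((l : ℝ) / 2) := by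
    rw [mul_pow, ← Real.rpow_natCast ((2 : ℝ) ^ _), ← Real.rpow_mul zero_le_two]
    gcongr
    · norm_num
    · push_cast
      have : (0 : ℝ) ≤ l := Nat.cast_nonneg _
      nlinarith
  have h4 : (∫ x, ‖G (2 * (l * E) + r) x‖) *
      (B * (2 : ℝ) ^ (((2 * (l * E) : ℕ) : ℝ) * c)) ^ m ≤
      B * (B ^ m * (2 : ℝ) ^ ((l : ℝ) / 2)) := by
    gcongr
    exact sf.integral_norm_le _
  calc ‖progForm P l F (fun _ => F)‖
      ≤ ‖progForm P l F (fun _ => F) -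
          progForm P l (G (2 * (l * E) + r)) (fun _ => G (2 * (l * E)))‖ +
        ‖progForm P l (G (2 * (l * E) + r)) (fun _ => G (2 * (l * E)))‖ :=
        norm_le_norm_sub_add _ _
    _ ≤ tailConst m r σ C B * 1 + B * (B ^ m * (2 : ℝ) ^ ((l : ℝ) / 2)) := by
        refine add_le_add (t1.trans ?_) (t2.trans h4)
        gcongr
    _ ≤ tailConst m r σ C B * (2 : ℝ) ^ ((l : ℝ) / 2) +
        B * (B ^ m * (2 : ℝ) ^ ((l : ℝ) / 2)) := by gcongr
    _ = _ := by ring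

/-- Crude, but it lets parameters be chosen proportional to inverse errors, without logarithms. -/
lemma two_rpow_neg_le {x : ℝ} (hx : 0 < x) : (2 : ℝ) ^ (-x) ≤ 2 / x := by
  have h1 : x / 2 ≤ (2 : ℝ) ^ x := by
    rw [Real.rpow_def_of_pos two_pos]
    have := Real.add_one_le_exp (Real.log 2 * x)
    have := Real.log_two_gt_d9
    nlinarith
  rw [Real.rpow_neg zero_le_two, ← one_div, div_le_div_iff₀ (by positivity) hx]
  linarith

/-- Here `Y` stands for the inverse of the main term up to constants. The energy error forces `J` of
order `Y²` and the Sobolev error forces `ν`, hence the spacing `L`, of order `Y`; the top frequency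
exponent `n₀`, about `J L`, is then of order `Y³`. -/
lemma exists_scale_parameters {κ₁ κ₂ κ₄ : ℝ} (h1 : 0 ≤ κ₁) (h2 : 0 ≤ κ₂) (h4 : 0 ≤ κ₄)
    (K E D : ℕ) : ∃ κ₅ : ℝ, 0 < κ₅ ∧ ∀ Y : ℝ, 1 ≤ Y → ∃ J ν L n₀ : ℕ,
      1 ≤ J ∧ κ₁ * Y ^ 2 ≤ J ∧ 1 ≤ ν ∧ κ₂ * Y ≤ ν ∧ ν + K + 3 ≤ L ∧ D ≤ L ∧
      2 * (J * L * E) + ν + 1 ≤ n₀ ∧ κ₄ * Y ≤ n₀ ∧ (n₀ : ℝ) ≤ κ₅ * Y ^ 3 := by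
  refine ⟨2 * ((κ₁ + 2) * (κ₂ + 2 + K + 3 + D) * E) + (κ₂ + 2) + 1 + (κ₄ + 1), by positivity,
    fun Y hY => ?_⟩
  have hY2 : 1 ≤ Y ^ 2 := one_le_pow₀ hY
  have hY3 : 1 ≤ Y ^ 3 := one_le_pow₀ hY
  have hYY3 : Y ≤ Y ^ 3 := le_self_pow₀ hY (by norm_num)
  set J := ⌈κ₁ * Y ^ 2⌉₊ + 1 with hJ
  set ν := ⌈κ₂ * Y⌉₊ + 1 with hν
  set L := ν + K + 3 + D with hL
  have hJle : (J : ℝ) ≤ (κ₁ + 2) * Y ^ 2 := by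
    rw [hJ]; push_cast
    linarith [Nat.ceil_lt_add_one (by positivity : 0 ≤ κ₁ * Y ^ 2)]
  have hνle : (ν : ℝ) ≤ (κ₂ + 2) * Y := by
    rw [hν]; push_cast
    linarith [Nat.ceil_lt_add_one (by positivity : 0 ≤ κ₂ * Y)]
  have hLle : (L : ℝ) ≤ (κ₂ + 2 + K + 3 + D) * Y := by
    rw [hL]; push_cast
    have : (K : ℝ) ≤ K * Y := le_mul_of_one_le_right (by positivity) hY
    have : (D : ℝ) ≤ D * Y := le_mul_of_one_le_right (by positivity) hY
    linarith
  refine ⟨J, ν, L, 2 * (J * L * E) + ν + 1 + ⌈κ₄ * Y⌉₊, by omega, ?_, by omega, ?_, by omega,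
    by omega, by omega, ?_, ?_⟩
  · rw [hJ]; push_cast; linarith [Nat.le_ceil (κ₁ * Y ^ 2)]
  · rw [hν]; push_cast; linarith [Nat.le_ceil (κ₂ * Y)]
  · push_cast
    have : (0 : ℝ) ≤ 2 * (J * L * E) + ν + 1 := by positivity
    linarith [Nat.le_ceil (κ₄ * Y)]
  · push_cast
    have a1 : (J : ℝ) * L * E ≤ (κ₁ + 2) * (κ₂ + 2 + K + 3 + D) * E * Y ^ 3 := by
      calc (J : ℝ) * L * E ≤ ((κ₁ + 2) * Y ^ 2) * ((κ₂ + 2 + K + 3 + D) * Y) * E := by gcongr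
        _ = _ := by ring
    have a2 : (κ₂ + 2) * Y ≤ (κ₂ + 2) * Y ^ 3 := by gcongr
    have a3 : κ₄ * Y ≤ κ₄ * Y ^ 3 := by gcongr
    have a4 := Nat.ceil_lt_add_one (by positivity : 0 ≤ κ₄ * Y)
    nlinarith

/-- Approximate progressions whose points all lie close to `A` have a limit in `A`. -/
lemma exists_progression_of_approx {A : Set ℝ} (hA : IsCompact A) (hA01 : A ⊆ Set.Icc 0 1) {τ : ℝ}
    (happ : ∀ n : ℕ, ∃ x t : ℝ, τ ≤ t ∧ t ≤ 1 ∧ (∃ p ∈ A, |x - p| ≤ (2 ^ n)⁻¹) ∧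
      ∀ i, ∃ p ∈ A, |x - (P i).eval t - p| ≤ (2 ^ n)⁻¹) :
    ∃ x ∈ A, ∃ t ∈ Set.Icc τ 1, ∀ i, x - (P i).eval t ∈ A := by
  have hne : A.Nonempty := by
    obtain ⟨x, t, -, -, ⟨p, hp, -⟩, -⟩ := happ 0
    exact ⟨p, hp⟩
  -- The total distance of the configuration to `A`: continuous, arbitrarily small on a compact set,
  -- hence zero at its minimizer.
  let Φ : ℝ × ℝ → ℝ := fun z =>
    Metric.infDist z.1 A + ∑ i, Metric.infDist (z.1 - (P i).eval z.2) A
  have hΦ : Continuous Φ := by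
    refine ((Metric.continuous_infDist_pt A).comp continuous_fst).add
      (continuous_finsetSum _ fun i _ => (Metric.continuous_infDist_pt A).comp ?_)
    exact continuous_fst.sub ((P i).continuous.comp continuous_snd)
  have hdist : ∀ (y : ℝ) (n : ℕ), (∃ p ∈ A, |y - p| ≤ (2 ^ n)⁻¹) →
      Metric.infDist y A ≤ (2 ^ n)⁻¹ := by
    rintro y n ⟨p, hp, hyp⟩
    exact (Metric.infDist_le_dist_of_mem hp).trans (by rwa [Real.dist_eq])
  have hval : ∀ n : ℕ, ∃ z ∈ Set.Icc (-1 : ℝ) 2 ×ˢ Set.Icc τ 1,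
      Φ z ≤ (m + 1) * (2 ^ n : ℝ)⁻¹ := by
    intro n
    obtain ⟨x, t, ht1, ht2, hx, hxi⟩ := happ n
    refine ⟨(x, t), ⟨?_, ht1, ht2⟩, ?_⟩
    · obtain ⟨p, hp, hxp⟩ := hx
      have h1 := hA01 hp
      have h2 : (2 ^ n : ℝ)⁻¹ ≤ 1 := inv_le_one_of_one_le₀ (one_le_pow₀ one_le_two)
      have h3 := abs_le.1 (hxp.trans h2)
      exact ⟨by linarith [h1.1, h3.1], by linarith [h1.2, h3.2]⟩
    · calc Φ (x, t) ≤ (2 ^ n : ℝ)⁻¹ + ∑ _i : Fin m, (2 ^ n : ℝ)⁻¹ :=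
            add_le_add (hdist _ _ hx) (Finset.sum_le_sum fun i _ => hdist _ _ (hxi i))
        _ = _ := by simp; ring
  have hK : IsCompact (Set.Icc (-1 : ℝ) 2 ×ˢ Set.Icc τ 1) := isCompact_Icc.prod isCompact_Icc
  obtain ⟨z, hz, hmin⟩ := hK.exists_isMinOn (by obtain ⟨z, hz, -⟩ := hval 0; exact ⟨z, hz⟩)
    hΦ.continuousOn
  have hz0 : Φ z ≤ 0 := by
    refine ge_of_tendsto' (f := fun n : ℕ => (m + 1) * (2 ^ n : ℝ)⁻¹) (x := Filter.atTop) ?_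
      fun n => ?_
    · have := (tendsto_inv_atTop_zero.comp
        (tendsto_pow_atTop_atTop_of_one_lt (one_lt_two : (1 : ℝ) < 2))).const_mul ((m : ℝ) + 1)
      simpa using this
    · obtain ⟨w, hw, hwle⟩ := hval n
      exact (hmin hw).trans hwle
  have hnn : ∀ y, 0 ≤ Metric.infDist y A := fun y => Metric.infDist_nonneg
  have hs0 : 0 ≤ ∑ i, Metric.infDist (z.1 - (P i).eval z.2) A := Finset.sum_nonneg fun i _ => hnn _
  have hmem : ∀ y, Metric.infDist y A ≤ 0 → y ∈ A := fun y hy =>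
    (hA.isClosed.mem_iff_infDist_zero hne).2 (le_antisymm hy (hnn y))
  refine ⟨z.1, hmem _ ?_, z.2, hz.2, fun i => hmem _ ?_⟩
  · simp only [Φ] at hz0; linarith
  · have h1 : Metric.infDist (z.1 - (P i).eval z.2) A ≤
        ∑ i, Metric.infDist (z.1 - (P i).eval z.2) A :=
      Finset.single_le_sum (f := fun i => Metric.infDist (z.1 - (P i).eval z.2) A)
        (fun i _ => hnn _) (Finset.mem_univ i)
    simp only [Φ] at hz0
    linarith [hnn z.1]

end

/-! ### Approximate progressions and conclusion. -/

noncomputable section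

lemma mul_two_rpow_neg_le {W ε x : ℝ} (hW : 0 ≤ W) (hx : 0 < x) (h : 8 * W ≤ x * ε) :
    W * (2 : ℝ) ^ (-x) ≤ ε / 4 := by
  calc W * (2 : ℝ) ^ (-x) ≤ W * (2 / x) := by gcongr; exact two_rpow_neg_le hx
    _ = 2 * W / x := by ring
    _ ≤ ε / 4 := by rw [div_le_div_iff₀ hx (by norm_num)]; linarith

/-- The weight `η = ε / (8Z)` makes the first term exactly `ε / 8`; the second then needs `J` of
order `ε⁻²`. -/
lemma balanced_error_le {Z ε M J : ℝ} (hZ : 0 < Z) (hε : 0 < ε) (hJ : 0 < J)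
    (h : 64 * Z ^ 2 * M ≤ J * ε ^ 2) :
    Z * (ε / (8 * Z)) + Z * (ε / (8 * Z))⁻¹ * (M / J) ≤ ε / 4 := by
  have h4 : Z * (ε / (8 * Z)) = ε / 8 := by field_simp
  have h5 : Z * (ε / (8 * Z))⁻¹ * (M / J) = 8 * Z ^ 2 * M / (ε * J) := by field_simp
  have h6 : 8 * Z ^ 2 * M / (ε * J) ≤ ε / 8 := by
    rw [div_le_div_iff₀ (by positivity) (by norm_num)]
    linarith
  rw [h4, h5]; linarith

lemma mul_le_of_div_mul_le {X D A ε N : ℝ} (hD : 0 < D) (hA : 0 < A) (hε : 0 < ε)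
    (h : X / (D * A) * (A / ε) ≤ N) : X ≤ N * (D * ε) := by
  have e : X / (D * A) * (A / ε) = X / (D * ε) := by field_simp
  rwa [e, div_le_iff₀ (by positivity)] at h

set_option maxHeartbeats 800000 in
/-- Sets of Hausdorff content at least `a` in dimension `1 - c`, with `c ≤ κ a^{6m}`, contain
approximate progressions at every scale, with step bounded away from zero. -/
lemma exists_approx_progression {m : ℕ} (hm : 1 ≤ m) {P : Fin m → ℝ[X]} (hP : RelativelyCurved P)
    {σ C : ℝ} (hE : SobolevEstimate P σ C) : ∃ κ : ℝ, 0 < κ ∧ ∀ (a c s : ℝ) (A : Set ℝ),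
      0 < a → a ≤ 1 → 0 < c → c ≤ κ * a ^ (6 * m) → 1 - c ≤ s → A ⊆ Set.Icc 0 1 →
      ENNReal.ofReal a ≤ hausdorffContent s A →
      ∃ τ : ℝ, 0 < τ ∧ ∀ n : ℕ, ∃ x t : ℝ, τ ≤ t ∧ t ≤ 1 ∧ (∃ p ∈ A, |x - p| ≤ (2 ^ n)⁻¹) ∧
        ∀ i, ∃ p ∈ A, |x - (P i).eval t - p| ≤ (2 ^ n)⁻¹ := by
  have hσ := hE.1
  have hC : 0 < C := hE.1.trans hE.2.1
  have hm1 : (1 : ℝ) ≤ m := by exact_mod_cast hm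
  obtain ⟨B₁, hB₁, hfro⟩ := exists_frostman
  obtain ⟨δ, c₁, C₀, hδ, hc₁, hC₀, hfam⟩ := exists_scaleFamily
  obtain ⟨B, hB, hfam⟩ := hfam B₁ hB₁
  obtain ⟨K, hK⟩ := exists_abs_eval_le P (half_pos hδ)
  set E := ∑ i, vanishingOrder (P i) with hEdef
  have hEE : ∀ i, vanishingOrder (P i) ≤ E := fun i =>
    Finset.single_le_sum (f := fun i => vanishingOrder (P i)) (fun _ _ => Nat.zero_le _)
      (Finset.mem_univ i)
  have hr : 2 * m ≤ 2 ^ (m + 1) := by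
    have := Nat.lt_two_pow_self (n := m)
    rw [pow_succ]; omega
  set tc := tailConst m (m + 1) σ C B with htc
  have htc0 : 0 ≤ tc := tailConst_nonneg hσ hC hB
  set A₀ : ℝ := (((6 / δ + 1) / c₁) ^ m)⁻¹ with hA₀
  have hA₀0 : 0 < A₀ := by positivity
  set Z : ℝ := m * (2 * B) ^ (m - 1) * (2 * B ^ 2) with hZ
  have hZ0 : 0 < Z := by positivity
  set W : ℝ := m * (2 * B * C * (4 * B) ^ m) with hW
  have hW0 : 0 < W := by positivity
  obtain ⟨κ₅, hκ₅, hpar⟩ := exists_scale_parameters (κ₁ := 64 * Z ^ 2 * m * C₀ / A₀ ^ 2)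
    (κ₂ := 8 * W / (σ * A₀)) (κ₄ := 32 * tc / (σ * A₀) + 1) (by positivity) (by positivity)
    (by positivity) K E ⌈C⌉₊
  -- The four bounds give, in order: bounded Frostman losses up to scale `n₀ + m + 1`, `c < 1`,
  -- decay of the Sobolev tail, and the growth bound `2^{l/2}`.
  set κ : ℝ := min (min (1 / (κ₅ + (m + 1 : ℕ))) (1 / 2))
    (min (σ / (4 * (m + 1))) (1 / (4 * (E * m) + 1))) with hκ
  have hκ0 : 0 < κ := by positivity
  refine ⟨κ, hκ0, fun a c s A ha ha1 hc hcκ hs hA hcont => ?_⟩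
  have hcκ' : c ≤ κ := hcκ.trans (mul_le_of_le_one_right hκ0.le (pow_le_one₀ ha.le ha1))
  have hc2 : c ≤ 1 / 2 := hcκ'.trans ((min_le_left _ _).trans (min_le_right _ _))
  have hcσ : c * (m + 1) ≤ σ / 4 := by
    have h1 : c ≤ σ / (4 * (m + 1)) := hcκ'.trans ((min_le_right _ _).trans (min_le_left _ _))
    rw [le_div_iff₀ (by positivity)] at h1
    linarith
  have hcE : 4 * (c * E * m) ≤ 1 := by
    have h1 : c ≤ 1 / (4 * (E * m) + 1) :=
      hcκ'.trans ((min_le_right _ _).trans (min_le_right _ _))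
    rw [le_div_iff₀ (by positivity)] at h1
    nlinarith
  set y := a ^ (m + 1) with hy
  have hy0 : 0 < y := by positivity
  have hy1 : y ≤ 1 := pow_le_one₀ ha.le ha1
  obtain ⟨J, ν, L, n₀, hJ1, hJ, hν1, hν, hL, hCL, hn₀, hn₀', hn₀Y⟩ := hpar y⁻¹ ((one_le_inv₀ hy0).2 hy1)
  have hcn : ((n₀ : ℝ) + (m + 1 : ℕ)) * c ≤ 1 := by
    have h1 : c ≤ 1 / (κ₅ + (m + 1 : ℕ)) * y ^ 3 := by
      refine hcκ.trans ?_
      -- The exponent `6m` enters because `3(m + 1) ≤ 6m` for `m ≥ 1`.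
      have h2 : a ^ (6 * m) ≤ y ^ 3 := by
        rw [hy, ← pow_mul]
        exact pow_le_pow_of_le_one ha.le ha1 (by omega)
      have h3 : κ ≤ 1 / (κ₅ + (m + 1 : ℕ)) := (min_le_left _ _).trans (min_le_left _ _)
      gcongr
    have h4 : (n₀ : ℝ) + (m + 1 : ℕ) ≤ (κ₅ + (m + 1 : ℕ)) * (y⁻¹) ^ 3 := by
      have : 1 ≤ (y⁻¹) ^ 3 := one_le_pow₀ ((one_le_inv₀ hy0).2 hy1)
      have h5 : (0 : ℝ) ≤ (m + 1 : ℕ) := Nat.cast_nonneg _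
      nlinarith
    calc ((n₀ : ℝ) + (m + 1 : ℕ)) * c
        ≤ ((κ₅ + (m + 1 : ℕ)) * (y⁻¹) ^ 3) * (1 / (κ₅ + (m + 1 : ℕ)) * y ^ 3) := by gcongr
      _ = 1 := by field_simp
  set ε := A₀ * y with hε
  have hε0 : 0 < ε := by positivity
  have hεy : y⁻¹ = A₀ / ε := by rw [hε]; field_simp
  set lmax := J * L with hlmax
  -- a step size below which the form is negligible
  obtain ⟨q, hq⟩ : ∃ q : ℕ, (tc + B ^ (m + 1)) * (2 : ℝ) ^ ((lmax : ℝ) / 2) *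
      (2 : ℝ) ^ (-((q : ℝ) / 2)) < ε / 4 := by
    set X := (tc + B ^ (m + 1)) * (2 : ℝ) ^ ((lmax : ℝ) / 2) with hX
    have hX0 : 0 < X := by positivity
    obtain ⟨q, hq⟩ := exists_nat_gt (16 * X / ε)
    have hq0 : (0 : ℝ) < q := lt_trans (by positivity) hq
    refine ⟨q, ?_⟩
    have h1 := two_rpow_neg_le (x := (q : ℝ) / 2) (by positivity)
    rw [div_lt_iff₀ hε0] at hq
    calc X * (2 : ℝ) ^ (-((q : ℝ) / 2)) ≤ X * (2 / ((q : ℝ) / 2)) := by gcongr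
      _ = 4 * X / q := by field_simp; norm_num
      _ < ε / 4 := by rw [div_lt_div_iff₀ hq0 (by norm_num)]; linarith
  -- The scale `l` found below depends on the density, but `l ≤ lmax`, and `q` and `lmax` are fixed
  -- before `n'`; hence the lower bound on the step is uniform.
  refine ⟨(2 ^ q : ℝ)⁻¹ / 2 ^ lmax, by positivity, fun n' => ?_⟩
  -- Fine enough for closeness `2^{-n'}`, for the lower bound at scale `l`, and for the growth bound
  -- at scale `l + q`.
  set n := n' + (n₀ + (m + 1)) + 2 * ((lmax + q) * E) with hn
  obtain ⟨F, f, hF, haf, hfA⟩ := hfro a c s A hc (by linarith) hs hA hcont n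
  obtain ⟨G, H, h, sf⟩ := hfam c n F f hc.le hF
  have hη : 0 < ε / (8 * Z) := by positivity
  obtain ⟨l, hLl, hlJ, hlow⟩ := sf.exists_scale_lower_bound hm hE hF hB hδ hc₁ hC₀ hc.le
    (by linarith) hcσ hr hν1 hL ((Nat.le_ceil C).trans (by exact_mod_cast hCL)) hJ1
    hP.one_le_vanishingOrder hEE hK hn₀ (by omega) hcn hη
  have hCl : C ≤ l := (Nat.le_ceil C).trans (by exact_mod_cast hCL.trans hLl)
  have b0 : ε ≤ (∫ x, f x) ^ (m + 1) / ((6 / δ + 1) / c₁) ^ m := by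
    rw [div_eq_mul_inv, ← hA₀, hε, mul_comm A₀]
    exact mul_le_mul_of_nonneg_right (pow_le_pow_left₀ ha.le haf _) hA₀0.le
  have b1 : tc * (2 : ℝ) ^ (-(n₀ : ℝ) * (σ / 4)) ≤ ε / 4 := by
    have h0 : (0 : ℝ) < n₀ := by exact_mod_cast (by omega : 0 < n₀)
    rw [neg_mul]
    refine mul_two_rpow_neg_le htc0 (by positivity) ?_
    have h2 : 32 * tc / (σ * A₀) * (A₀ / ε) ≤ n₀ := by
      rw [← hεy]
      refine le_trans (mul_le_mul_of_nonneg_right ?_ (inv_nonneg.2 hy0.le)) hn₀'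
      exact le_add_of_nonneg_right zero_le_one
    have h3 := mul_le_of_div_mul_le hσ hA₀0 hε0 h2
    linarith
  have b2 : m * (2 * B * (C * (2 : ℝ) ^ (-(ν : ℝ) * σ)) * (4 * B) ^ m) ≤ ε / 4 := by
    have h0 : (0 : ℝ) < ν := by exact_mod_cast (by omega : 0 < ν)
    rw [hεy] at hν
    have h3 := mul_le_of_div_mul_le hσ hA₀0 hε0 hν
    have e : m * (2 * B * (C * (2 : ℝ) ^ (-(ν : ℝ) * σ)) * (4 * B) ^ m) =
        W * (2 : ℝ) ^ (-((ν : ℝ) * σ)) := by rw [hW, neg_mul]; ring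
    rw [e]
    exact mul_two_rpow_neg_le hW0.le (by positivity) (by linarith)
  have b3 : m * ((2 * B) ^ (m - 1) * (ε / (8 * Z) * (2 * B ^ 2) +
      (ε / (8 * Z))⁻¹ * (m * (C₀ * (2 * B ^ 2)) / J))) ≤ ε / 4 := by
    have hJ0 : (0 : ℝ) < J := by exact_mod_cast (by omega : 0 < J)
    have h3 : 64 * Z ^ 2 * (m * C₀) ≤ J * ε ^ 2 := by
      rw [hεy, div_pow, div_mul_div_cancel₀ (by positivity), div_le_iff₀ (by positivity)] at hJ
      linarith
    have e : m * ((2 * B) ^ (m - 1) * (ε / (8 * Z) * (2 * B ^ 2) +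
        (ε / (8 * Z))⁻¹ * (m * (C₀ * (2 * B ^ 2)) / J))) =
        Z * (ε / (8 * Z)) + Z * (ε / (8 * Z))⁻¹ * (m * C₀ / J) := by
      generalize ε / (8 * Z) = η
      rw [hZ]; ring
    rw [e]
    exact balanced_error_le hZ0 hε0 hJ0 h3
  have hmain : ε / 4 ≤ (progForm P l F (fun _ => F)).re := by
    linarith
  by_contra hcon
  push Not at hcon
  -- A nonzero value of the integrand with `t > 2^{-q}` would be an approximate progression with
  -- step `t / 2^l` at least the chosen bound.
  have hvan : ∀ x, ∀ t ∈ Set.Ioc (((2 : ℝ) ^ q)⁻¹) 1,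
      progIntegrand P l F (fun _ => F) (x, t) = 0 := by
    intro x t ht
    by_contra hne
    rw [progIntegrand, mul_eq_zero, not_or, Finset.prod_eq_zero_iff] at hne
    push Not at hne
    obtain ⟨hx, hxi⟩ := hne
    have hnear : ∀ z, F z ≠ 0 → ∃ p ∈ A, |z - p| ≤ (2 ^ n' : ℝ)⁻¹ := by
      intro z hz
      obtain ⟨p, hp, hzp⟩ := hfA z (by intro h0; exact hz (by rw [hF.eq_coe, h0]; simp))
      refine ⟨p, hp, hzp.trans ?_⟩
      exact inv_anti₀ (by positivity) (pow_le_pow_right₀ one_le_two (by omega))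
    have ht0 : (0 : ℝ) < t := lt_trans (by positivity) ht.1
    obtain ⟨i, hi⟩ := hcon x (t / 2 ^ l) (by
      have : (2 : ℝ) ^ l ≤ 2 ^ lmax := pow_le_pow_right₀ one_le_two hlJ
      have := ht.1.le
      gcongr) (div_le_one_of_le₀ (ht.2.trans (one_le_pow₀ one_le_two)) (by positivity))
      (hnear x hx)
    obtain ⟨p, hp, hzp⟩ := hnear _ (hxi i (Finset.mem_univ i))
    exact absurd hzp (not_le.2 (hi p hp))
  have e1 := progForm_eq_smul_of_vanish q hvan
  have hlq : C ≤ ((l + q : ℕ) : ℝ) := by push_cast; linarith [(Nat.cast_nonneg q : (0 : ℝ) ≤ q)]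
  have hup := sf.norm_progForm_le_rpow hm hE hlq hB hc.le (by linarith) hcσ hr hEE hcE (by
    have : (l + q) * E ≤ (lmax + q) * E := by gcongr
    omega)
  have h7 : ‖progForm P l F (fun _ => F)‖ < ε / 4 := by
    rw [e1, norm_mul, norm_inv, norm_pow, Complex.norm_ofNat]
    refine lt_of_le_of_lt ?_ hq
    have hlr : (l : ℝ) ≤ lmax := by exact_mod_cast hlJ
    calc ((2 : ℝ) ^ q)⁻¹ * ‖progForm P (l + q) F (fun _ => F)‖
        ≤ ((2 : ℝ) ^ q)⁻¹ * ((tc + B ^ (m + 1)) * (2 : ℝ) ^ (((l + q : ℕ) : ℝ) / 2)) := by gcongr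
      _ = (tc + B ^ (m + 1)) * (2 : ℝ) ^ (-(q : ℝ) + ((l + q : ℕ) : ℝ) / 2) := by
          rw [Real.rpow_add two_pos, Real.rpow_neg zero_le_two, Real.rpow_natCast]; ring
      _ ≤ (tc + B ^ (m + 1)) * (2 : ℝ) ^ ((lmax : ℝ) / 2 + -((q : ℝ) / 2)) := by
          refine mul_le_mul_of_nonneg_left (Real.rpow_le_rpow_of_exponent_le one_le_two ?_)
            (by positivity)
          push_cast; linarith
      _ = _ := by rw [Real.rpow_add two_pos]; ring
  have h8 := (Complex.re_le_norm (progForm P l F (fun _ => F)))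
  linarith

end

theorem theorem1p4 (m : ℕ) (hm : 1 ≤ m) :
    ∃ Cm : ℝ, 0 < Cm ∧
      ∀ P : Fin m → ℝ[X], RelativelyCurved P →
      ∀ σ C : ℝ, SobolevEstimate P σ C →
      ∃ c₀ : ℝ, 0 < c₀ ∧
        ∀ a c s : ℝ, 0 < a → c ≤ c₀ → c ≤ Cm * σ * a ^ (10 * m) → 1 - c < s →
        ∀ A : Set ℝ, IsCompact A → A ⊆ Set.Icc 0 1 →
          ENNReal.ofReal a ≤ hausdorffContent s A →
          ∃ x ∈ Set.Icc (0 : ℝ) 1, ∃ t ∈ Set.Icc (0 : ℝ) 1, t ≠ 0 ∧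
            x ∈ A ∧ ∀ i, x - (P i).eval t ∈ A := by
  refine ⟨1, one_pos, fun P hP σ C hE => ?_⟩
  have hσ := hE.1
  obtain ⟨κ, hκ, hprog⟩ := exists_approx_progression hm hP hE
  refine ⟨min (κ ^ 3 / σ ^ 2) (1 / 2), by positivity, fun a c s ha hc₀ hcσ hs A hA hA01 hcont => ?_⟩
  -- The given `c` need not be positive; it is enlarged to the greatest admissible value, which only
  -- weakens the condition on `s`.
  set c' := min (min (κ ^ 3 / σ ^ 2) (1 / 2)) (σ * a ^ (10 * m)) with hc'
  have hc'0 : 0 < c' := by positivity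
  have hcc' : c ≤ c' := le_min hc₀ (by linarith)
  have hc'half : c' ≤ 1 / 2 := (min_le_left _ _).trans (min_le_right _ _)
  have hc'κ : c' ≤ κ ^ 3 / σ ^ 2 := (min_le_left _ _).trans (min_le_left _ _)
  have hc'σ : c' ≤ σ * a ^ (10 * m) := min_le_right _ _
  have hs' : 1 - c' ≤ s := by linarith
  -- A Frostman density for `A` has mass at least `a` and at most `1`.
  have ha1 : a ≤ 1 := by
    obtain ⟨B, -, hfro⟩ := exists_frostman
    obtain ⟨F, f, hF, haf, -⟩ := hfro a c' s A hc'0 (by linarith) hs' hA01 hcont 0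
    exact haf.trans hF.integral_le_one
  -- Multiplying `c' ≤ κ³ / σ²` by the square of `c' ≤ σ a^{10m}` cancels `σ` and gives `c'³ ≤ κ³
  -- a^{20m}`. This is how `C_m` stays independent of the polynomials while `c₀` carries all other
  -- constants.
  have hc'a : c' ≤ κ * a ^ (6 * m) := by
    refine le_of_pow_le_pow_left₀ (n := 3) (by norm_num) (by positivity) ?_
    calc c' ^ 3 = c' * c' ^ 2 := by ring
      _ ≤ κ ^ 3 / σ ^ 2 * (σ * a ^ (10 * m)) ^ 2 := by gcongr
      _ = κ ^ 3 * a ^ (20 * m) := by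
          rw [mul_pow, ← pow_mul]
          field_simp
          ring_nf
      _ ≤ κ ^ 3 * a ^ (18 * m) :=
          mul_le_mul_of_nonneg_left (pow_le_pow_of_le_one ha.le ha1 (by omega)) (by positivity)
      _ = (κ * a ^ (6 * m)) ^ 3 := by rw [mul_pow, ← pow_mul]; congr 2; ring
  obtain ⟨τ, hτ, happ⟩ := hprog a c' s A ha ha1 hc'0 hc'a hs' hA01 hcont
  obtain ⟨x, hx, t, ht, hxt⟩ := exists_progression_of_approx hA hA01 happ
  exact ⟨x, hA01 hx, t, ⟨hτ.le.trans ht.1, ht.2⟩, (hτ.trans_le ht.1).ne', hx, hxt⟩
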